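/- Let $\mathfrak g$ be a real Lie algebra with centre $\mathfrak z$ and an inner product, and let $\mathfrak b=\mathfrak z^{\perp}$. Assume that $\mathfrak g$ is the Lie algebra of a Métivier group, that is, $[\mathfrak g,\mathfrak g]\subseteq\mathfrak z$ and, for every non-zero $\omega\in\mathfrak z^*$, the skew-symmetric bilinear form $(X,Y)\mapsto\omega([X,Y])$ on $\mathfrak b$ is non-degenerate. Let $n\ge 2$, and let $B_1,\dots,B_{2n}$ and $Z_1,\dots,Z_m$ be orthonormal bases of $\mathfrak b$ and $\mathfrak z$. Define real $2n\times 2n$ matrices $U^{(k)}$ by $[B_j,B_l]=\sum_{k=1}^m U^{(k)}_{j,l}Z_k$. The complexification of $(x_1,\dots,x_n,y_1,\dots,y_n)\in\mathbb R^{2n}$ is $(x_1+iy_1,\dots,x_n+iy_n)\in\mathbb C^n$; through it real $2n\times 2n$ matrices act on $\mathbb C^n$. Let $\lambda\in\mathbb R^m\setminus\{0\}$. For a continuous $f:\mathbb C^n\to\mathbb C$ and $r>0$ define the $\lambda$-twisted spherical mean $$f\times_\lambda\mu_r(z)=\int_{|w|=r}f(z-w)\,e^{\frac i2\sum_{k=1}^m\lambda_k\,\mathrm{Re}\,(z\cdot\overline{U^{(k)}w})}\,d\mu_r(w),$$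 where $\mu_r$ is the normalized surface measure on $\{|w|=r\}\subset\mathbb C^n$ and $a\cdot b=\sum_{j}a_jb_j$. Put $V_\lambda=\sum_k\lambda_kU^{(k)}$, and let $A_\lambda=(\sqrt2\,v_1,\dots,\sqrt2\,v_n,\sqrt2\,u_1,\dots,\sqrt2\,u_n)$ be an orthogonal matrix such that $u_j\pm iv_j$ are eigenvectors of $V_\lambda$ with the eigenvalues $\pm i\mu_{\lambda,j}$, where $\mu_{\lambda,1}\ge\dots\ge\mu_{\lambda,n}>0$. For $K\subset\mathbb C^n$ put $K_\lambda=\{z\in\mathbb C^n: A_\lambda z\in K\}$. A complex cone is a set $K\subset\mathbb C^n$ with $cz\in K$ for all $z\in K$ and $c\in\mathbb C$. It is called non-harmonic if it is not contained in the zero set of any non-zero bi-graded homogeneous harmonic polynomial, that is, of any non-zero polynomial $P(z)=\sum_{|\alpha|=p,\,|\beta|=q}c_{\alpha\beta}z^\alpha\bar z^\beta$ with $\Delta P=0$ (for any $p,q\ge 0$). Theorem. Let $K\subset\mathbb C^n$ be a non-harmonic complex cone such that $K_\lambda$ contains one of the coordinate axes $\{z\in\mathbb C^n: z_l=0\text{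 for all }l\ne j\}$, $1\le j\le n$. Let $f$ be a continuous function on $\mathbb C^n$ such that $f\times_\lambda\mu_r(z)=0$ for all $r>0$ and all $z\in K$. Then $f=0$. -/

import Mathlib

open MeasureTheory Matrix

noncomputable section

namespace Metivier

/-! ### Métivier Lie algebras and their structure constants -/

section LieAlgebraSide

variable {𝔤 : Type*} [LieRing 𝔤] [LieAlgebra ℝ 𝔤]

/-- The centre `𝔷` of the Lie algebra `𝔤`, as a linear subspace. -/
abbrev centre (𝔤 : Type*) [LieRing 𝔤] [LieAlgebra ℝ 𝔤] : Submodule ℝ 𝔤 :=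
  (LieAlgebra.center ℝ 𝔤).toSubmodule

/-- The orthogonal complement `𝔟` of the centre with respect to the inner product `g`. -/
def horizontal (g : LinearMap.BilinForm ℝ 𝔤) : Submodule ℝ 𝔤 where
  carrier := {X | ∀ Z ∈ centre 𝔤, g X Z = 0}
  add_mem' := by
    intro X Y hX hY Z hZ
    simp [hX Z hZ, hY Z hZ]
  zero_mem' := by
    intro Z _
    simp
  smul_mem' := by
    intro c X hX Z hZ
    simp [hX Z hZ]

/-- `𝔤`, with the inner product `g`, is the Lie algebra of a Métivier group: it is step two nilpotent
(brackets are central) and, for every non-zero `ω ∈ 𝔷*`, the skew-symmetric bilinear form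
`B_ω(X, Y) = ω [X, Y]` on `𝔟 = 𝔷^⊥` is non-degenerate.  The (connected, simply connected) group is
`𝔤` itself in exponential coordinates. -/
structure IsMetivier (g : LinearMap.BilinForm ℝ 𝔤) : Prop where
  symm : ∀ X Y, g X Y = g Y X
  pos : ∀ X, X ≠ 0 → 0 < g X X
  step_two : ∀ X Y : 𝔤, ⁅X, Y⁆ ∈ centre 𝔤
  nondegenerate : ∀ ω : Module.Dual ℝ (centre 𝔤), ω ≠ 0 →
    ∀ X ∈ horizontal g, (∀ Y ∈ horizontal g, ω ⟨⁅X, Y⁆, step_two X Y⟩ = 0) → X = 0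

/-- A basis of a subspace that is orthonormal for the inner product `g`. -/
def IsOrthonormalFor {ι : Type*} [DecidableEq ι] (g : LinearMap.BilinForm ℝ 𝔤)
    {S : Submodule ℝ 𝔤} (b : Module.Basis ι ℝ S) : Prop :=
  ∀ i j, g (b i : 𝔤) (b j : 𝔤) = if i = j then 1 else 0

/-- The structure matrices `U^{(k)}` defined by `[B_j, B_l] = ∑_k U^{(k)}_{j,l} Z_k`.  The index set
`Fin n ⊕ Fin n` is `{1, …, 2n}`, split into the first `n` and the last `n` indices. -/
def structureMatrix {n m : ℕ} {g : LinearMap.BilinForm ℝ 𝔤} (hg : IsMetivier g)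
    (B : Module.Basis (Fin n ⊕ Fin n) ℝ (horizontal g)) (Z : Module.Basis (Fin m) ℝ (centre 𝔤))
    (k : Fin m) : Matrix (Fin n ⊕ Fin n) (Fin n ⊕ Fin n) ℝ :=
  Matrix.of fun j l => Z.repr ⟨⁅(B j : 𝔤), (B l : 𝔤)⁆, hg.step_two _ _⟩ k

end LieAlgebraSide

/-! ### Real and complex coordinates -/

/-- `ℂⁿ` with its Euclidean norm. -/
abbrev Cn (n : ℕ) : Type := EuclideanSpace ℂ (Fin n)

/-- The complexification `(x_1 + i y_1, …, x_n + i y_n)` of `(x_1, …, x_n, y_1, …, y_n)`. -/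
def complexify {n : ℕ} (x : Fin n ⊕ Fin n → ℝ) : Cn n :=
  WithLp.toLp 2 fun j => (x (Sum.inl j) : ℂ) + (x (Sum.inr j) : ℂ) * Complex.I

/-- The vector `(x_1, …, x_n, y_1, …, y_n)` whose complexification is `z`. -/
def realify {n : ℕ} (z : Cn n) : Fin n ⊕ Fin n → ℝ :=
  Sum.elim (fun j => (z j).re) (fun j => (z j).im)

/-- The action of a real `2n × 2n` matrix on `ℂⁿ`, through complexification. -/
def act {n : ℕ} (M : Matrix (Fin n ⊕ Fin n) (Fin n ⊕ Fin n) ℝ) (z : Cn n) : Cn n :=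
  complexify (M *ᵥ realify z)

/-! ### The twisted spherical means -/

/-- The normalized surface measure `μ_s` on the sphere `|w| = s` of `ℂⁿ`: the image of the normalized
surface measure of the unit sphere under `w ↦ s w`. -/
def sphereMeasure (n : ℕ) (s : ℝ) : Measure (Cn n) :=
  (((volume : Measure (Cn n)).toSphere Set.univ)⁻¹ • (volume : Measure (Cn n)).toSphere).map
    fun w : Metric.sphere (0 : Cn n) 1 => s • (w : Cn n)

/-- The `λ`-twisted spherical mean
`f ×_λ μ_s (z) = ∫_{|w| = s} f(z - w) exp((i/2) ∑_k λ_k Re (z · conj (U^{(k)} w))) dμ_s(w)`. -/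
def twistedMean {n m : ℕ} (U : Fin m → Matrix (Fin n ⊕ Fin n) (Fin n ⊕ Fin n) ℝ)
    (lam : Fin m → ℝ) (f : Cn n → ℂ) (s : ℝ) (z : Cn n) : ℂ :=
  ∫ w, f (z - w) * Complex.exp (Complex.I / 2 *
    ((∑ k, lam k * (∑ l, z l * (starRingEnd ℂ) (act (U k) w l)).re : ℝ) : ℂ)) ∂(sphereMeasure n s)

/-! ### Non-harmonic complex cones -/

/-- Polynomials in `z` and `z̄`: the variable `Sum.inl j` is `z_j`, the variable `Sum.inr j` is
`z̄_j`. -/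
abbrev BiPoly (n : ℕ) : Type := MvPolynomial (Fin n ⊕ Fin n) ℂ

/-- The value of a polynomial in `z, z̄` at a point `z ∈ ℂⁿ`. -/
def evalAt {n : ℕ} (P : BiPoly n) (z : Cn n) : ℂ :=
  MvPolynomial.eval (Sum.elim (fun j => z j) (fun j => (starRingEnd ℂ) (z j))) P

/-- The Laplacian `Δ = 4 ∑_j ∂²/∂z_j ∂z̄_j` of `ℂⁿ` on polynomials in `z, z̄`. -/
def laplacian {n : ℕ} (P : BiPoly n) : BiPoly n :=
  4 * ∑ j, MvPolynomial.pderiv (Sum.inl j) (MvPolynomial.pderiv (Sum.inr j) P)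

/-- `P ∈ H_{p,q}`: the polynomial `P` is homogeneous of degree `p` in `z` and of degree `q` in `z̄`,
and harmonic. -/
def IsBigradedHarmonic {n : ℕ} (p q : ℕ) (P : BiPoly n) : Prop :=
  (∀ d ∈ P.support, ∑ j, d (Sum.inl j) = p ∧ ∑ j, d (Sum.inr j) = q) ∧ laplacian P = 0

/-- A complex cone: a subset of `ℂⁿ` that is closed under complex scaling. -/
def IsComplexCone {n : ℕ} (K : Set (Cn n)) : Prop :=
  ∀ z ∈ K, ∀ c : ℂ, c • z ∈ K

/-- `K` is non-harmonic: it is not contained in the zero set of any non-zero bi-graded homogeneous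
harmonic polynomial. -/
def IsNonHarmonic {n : ℕ} (K : Set (Cn n)) : Prop :=
  ∀ (p q : ℕ) (P : BiPoly n), IsBigradedHarmonic p q P → P ≠ 0 → ∃ z ∈ K, evalAt P z ≠ 0

/-! ### The rotation `A_λ` and the transformed cone `K_λ` -/

/-- The skew-symmetric matrix `V_λ = ∑_k λ_k U^{(k)}`. -/
def VMatrix {n m : ℕ} (U : Fin m → Matrix (Fin n ⊕ Fin n) (Fin n ⊕ Fin n) ℝ)
    (lam : Fin m → ℝ) : Matrix (Fin n ⊕ Fin n) (Fin n ⊕ Fin n) ℝ :=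
  ∑ k, lam k • U k

/-- `A` is an orthogonal matrix `(√2 v_1, …, √2 v_n, √2 u_1, …, √2 u_n)`, where `u_j ± i v_j` are
eigenvectors of `V` with the eigenvalues `± i μ_j`, `μ_1 ≥ … ≥ μ_n > 0`.  In terms of `A` the
eigenvalue equations `V v_j = μ_j u_j`, `V u_j = - μ_j v_j` say that `V A = A [[0, -J], [J, 0]]` with
`J = diag(μ_1, …, μ_n)`. -/
structure IsNormalizing {n : ℕ} (V : Matrix (Fin n ⊕ Fin n) (Fin n ⊕ Fin n) ℝ)
    (μ : Fin n → ℝ) (A : Matrix (Fin n ⊕ Fin n) (Fin n ⊕ Fin n) ℝ) : Prop where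
  antitone : Antitone μ
  pos : ∀ j, 0 < μ j
  orthogonal : A * Aᵀ = 1
  intertwine : V * A =
    A * Matrix.fromBlocks 0 (-Matrix.diagonal μ) (Matrix.diagonal μ) 0

/-- The transformed cone: `z ∈ K_λ` iff the complexification of `A x` lies in `K`, where `z` is the
complexification of `x`. -/
def transformedCone {n : ℕ} (A : Matrix (Fin n ⊕ Fin n) (Fin n ⊕ Fin n) ℝ)
    (K : Set (Cn n)) : Set (Cn n) :=
  {z | act A z ∈ K}

/-- The set contains one of the (complex) coordinate axes of `ℂⁿ`. -/
def ContainsCoordinateAxis {n : ℕ} (S : Set (Cn n)) : Prop :=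
  ∃ j : Fin n, ∀ c : ℂ, EuclideanSpace.single j c ∈ S

end Metivier

end

/-!
For `z ∈ K` and real `t`, the point `t z` lies in `K`.  Integrate the twisted means with centre `t z`
over the radius, against a truncated power of `R + t²|z|² - |w|²`, and substitute `w = t z - u`.  Up
to a factor that does not vanish, this gives

`∫ f(u) (R - |u|² + 2 t ⟨u, z⟩)_+^(k+1) exp(-(i/2) t ω(z, u)) du = 0`,

where `ω(z, u) = ∑ λ_k Re (z · conj (U^{(k)} u))` is real bilinear.  The coefficient of `t^k` of the
left-hand side is a combination of the moments

`∫ f(u) (R - |u|²)_+^(k+1-a) ⟨u, z⟩^a ω(z, u)^(k-a) du`,  `0 ≤ a ≤ k`,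

(`sum_truncMoment_eq_zero`).  So the moment of `⟨u, z⟩^k` of order one, that is with the weight
`(R - |u|²)_+`, is a sum of moments of orders `2, …, k + 1` of other homogeneous polynomials of
degree `k`.

That `K` is a non-harmonic complex cone means, by duality, that the powers `⟨u, z⟩^k`, `z ∈ K`, span
the homogeneous polynomials of degree `k` in `u, ū` modulo multiples of `|u|²`
(`homogeneous_mem_span`).  By induction on `k`, the multiples of `|u|²` have vanishing first moments.
Hence every first moment in degree `k` is a sum of moments of higher order in the same degree.  Since
the derivative in `R` of the moment of order `m + 1` is `m + 1` times the moment of order `m`, the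
moments of orders `2, …, k + 1` solve a linear system of differential equations with constant
coefficients, with initial value zero at `R = 0`.  So they vanish
(`truncMoment_eq_zero_of_reduction`), and then so do the first moments.  A continuous function all of
whose moments vanish is zero, by the Stone–Weierstrass theorem.
-/

noncomputable section

namespace Metivier

open MvPolynomial

variable {n : ℕ}

/-! ### Powers of linear forms and harmonic polynomials -/

/-- The polynomial obtained by applying the functional `ℓ` to each coefficient of `Q`. -/
def mapCoeff {σ : Type*} {M : Type*} [CommRing M] [Algebra ℂ M] (ℓ : M →ₗ[ℂ] ℂ)
    (Q : MvPolynomial σ M) : MvPolynomial σ ℂ :=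
  ∑ d ∈ Q.support, monomial d (ℓ (Q.coeff d))

section mapCoeff

variable {σ M : Type*} [CommRing M] [Algebra ℂ M] (ℓ : M →ₗ[ℂ] ℂ)

@[simp]
lemma coeff_mapCoeff (Q : MvPolynomial σ M) (d : σ →₀ ℕ) :
    (mapCoeff ℓ Q).coeff d = ℓ (Q.coeff d) := by
  classical
  simp only [mapCoeff, coeff_sum, coeff_monomial, Finset.sum_ite_eq', mem_support_iff, ne_eq,
    ite_eq_left_iff, not_not]
  intro h
  simp [h]

lemma mapCoeff_add (Q Q' : MvPolynomial σ M) :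
    mapCoeff ℓ (Q + Q') = mapCoeff ℓ Q + mapCoeff ℓ Q' := by
  ext d; simp

lemma mapCoeff_sum {ι : Type*} (s : Finset ι) (Q : ι → MvPolynomial σ M) :
    mapCoeff ℓ (∑ i ∈ s, Q i) = ∑ i ∈ s, mapCoeff ℓ (Q i) := by
  ext d; simp [coeff_sum]

lemma mapCoeff_natCast_mul (N : ℕ) (Q : MvPolynomial σ M) :
    mapCoeff ℓ ((N : MvPolynomial σ M) * Q) = (N : MvPolynomial σ ℂ) * mapCoeff ℓ Q := by
  ext d; simp [← nsmul_eq_mul]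

lemma mapCoeff_C_mul (c : M) (Q : MvPolynomial σ M) :
    mapCoeff ℓ (C c * Q) = mapCoeff (ℓ ∘ₗ LinearMap.mulLeft ℂ c) Q := by
  ext d; simp

lemma mapCoeff_monomial (d : σ →₀ ℕ) (c : M) :
    mapCoeff ℓ (monomial d c) = monomial d (ℓ c) := by
  classical
  ext e; simp only [coeff_mapCoeff, coeff_monomial]; split_ifs <;> simp

lemma mapCoeff_pderiv (i : σ) (Q : MvPolynomial σ M) :
    pderiv i (mapCoeff ℓ Q) = mapCoeff ℓ (pderiv i Q) := by
  induction Q using MvPolynomial.induction_on' with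
  | monomial d c =>
    rw [mapCoeff_monomial, pderiv_monomial, pderiv_monomial, mapCoeff_monomial, mul_comm c,
      ← nsmul_eq_mul, map_nsmul, nsmul_eq_mul, mul_comm]
  | add p q hp hq => rw [mapCoeff_add, map_add, hp, hq, map_add, mapCoeff_add]

lemma eval_mapCoeff (y : σ → ℂ) (Q : MvPolynomial σ M) :
    eval y (mapCoeff ℓ Q) = ℓ (eval (fun s => algebraMap ℂ M (y s)) Q) := by
  induction Q using MvPolynomial.induction_on' with
  | monomial d c =>
    rw [mapCoeff_monomial, eval_monomial, eval_monomial]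
    have : (d.prod fun s e => (algebraMap ℂ M (y s)) ^ e) =
        algebraMap ℂ M (d.prod fun s e => y s ^ e) := by
      simp [Finsupp.prod, map_prod]
    rw [this, mul_comm c, ← Algebra.smul_def, map_smul, smul_eq_mul, mul_comm]
  | add p q hp hq => rw [mapCoeff_add, map_add, hp, hq, map_add, map_add]

end mapCoeff

/-- The form `∑ z_j X̄_j`.  It is a polynomial in the outer variables `z, z̄`, whose coefficients are
polynomials in the inner variables `X, X̄`. -/
def genericHol (n : ℕ) : MvPolynomial (Fin n ⊕ Fin n) (BiPoly n) :=
  ∑ j, C (X (Sum.inr j)) * X (Sum.inl j)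

/-- The form `∑ z̄_j X_j`, with outer variables `z, z̄` and inner variables `X, X̄`. -/
def genericAnti (n : ℕ) : MvPolynomial (Fin n ⊕ Fin n) (BiPoly n) :=
  ∑ j, C (X (Sum.inl j)) * X (Sum.inr j)

/-- The polynomial `|u|² = ∑ u_j ū_j`. -/
def normSqPoly (n : ℕ) : BiPoly n := ∑ j, X (Sum.inl j) * X (Sum.inr j)

/-- The polynomial `u ↦ ∑ z_j ū_j`. -/
def antiPoly (z : Cn n) : BiPoly n := ∑ j, C (z j) * X (Sum.inr j)

/-- The polynomial `u ↦ ∑ z̄_j u_j`. -/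
def holPoly (z : Cn n) : BiPoly n := ∑ j, C ((starRingEnd ℂ) (z j)) * X (Sum.inl j)

lemma isHomogeneous_antiPoly (z : Cn n) : (antiPoly z).IsHomogeneous 1 :=
  IsHomogeneous.sum _ _ _ fun j _ => by
    simpa using (isHomogeneous_C _ (z j)).mul (isHomogeneous_X ℂ (Sum.inr j))

lemma isHomogeneous_holPoly (z : Cn n) : (holPoly z).IsHomogeneous 1 :=
  IsHomogeneous.sum _ _ _ fun j _ => by
    simpa using (isHomogeneous_C _ ((starRingEnd ℂ) (z j))).mul (isHomogeneous_X ℂ (Sum.inl j))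

lemma pderiv_inl_genericHol (j : Fin n) :
    pderiv (Sum.inl j) (genericHol n) = C (X (Sum.inr j)) := by
  classical
  simp [genericHol, pderiv_X, Pi.single_apply, Derivation.leibniz]

lemma pderiv_inr_genericHol (j : Fin n) : pderiv (Sum.inr j) (genericHol n) = 0 := by
  simp [genericHol, pderiv_X, Derivation.leibniz]

lemma pderiv_inl_genericAnti (j : Fin n) : pderiv (Sum.inl j) (genericAnti n) = 0 := by
  simp [genericAnti, pderiv_X, Derivation.leibniz]

lemma pderiv_inr_genericAnti (j : Fin n) :
    pderiv (Sum.inr j) (genericAnti n) = C (X (Sum.inl j)) := by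
  classical
  simp [genericAnti, pderiv_X, Pi.single_apply, Derivation.leibniz]

lemma isHomogeneous_eval_genericHol (y : Fin n ⊕ Fin n → ℂ) :
    (eval (fun s => algebraMap ℂ (BiPoly n) (y s)) (genericHol n)).IsHomogeneous 1 := by
  simp only [genericHol, map_sum, map_mul, eval_C, eval_X]
  exact IsHomogeneous.sum _ _ _ fun j _ => by
    simpa using (isHomogeneous_X ℂ (Sum.inr j)).mul (isHomogeneous_C _ (y (Sum.inl j)))

lemma isHomogeneous_eval_genericAnti (y : Fin n ⊕ Fin n → ℂ) :
    (eval (fun s => algebraMap ℂ (BiPoly n) (y s)) (genericAnti n)).IsHomogeneous 1 := by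
  simp only [genericAnti, map_sum, map_mul, eval_C, eval_X]
  exact IsHomogeneous.sum _ _ _ fun j _ => by
    simpa using (isHomogeneous_X ℂ (Sum.inl j)).mul (isHomogeneous_C _ (y (Sum.inr j)))

/-- The polynomial `z ↦ ℓ ((z · X̄)^a (z̄ · X)^b)`, of bidegree `(a, b)`. -/
def dualPoly (ℓ : BiPoly n →ₗ[ℂ] ℂ) (a b : ℕ) : BiPoly n :=
  mapCoeff ℓ (genericHol n ^ a * genericAnti n ^ b)

lemma evalAt_dualPoly (ℓ : BiPoly n →ₗ[ℂ] ℂ) (a b : ℕ) (z : Cn n) :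
    evalAt (dualPoly ℓ a b) z = ℓ (antiPoly z ^ a * holPoly z ^ b) := by
  rw [evalAt, dualPoly, eval_mapCoeff]
  simp [genericHol, genericAnti, antiPoly, holPoly, mul_comm, MvPolynomial.algebraMap_eq]

lemma dualPoly_eq_zero {ℓ : BiPoly n →ₗ[ℂ] ℂ} {a b : ℕ}
    (h : ∀ P : BiPoly n, P.IsHomogeneous (a + b) → ℓ P = 0) : dualPoly ℓ a b = 0 := by
  refine MvPolynomial.funext fun y => ?_
  rw [dualPoly, eval_mapCoeff, map_mul, map_pow, map_pow, map_zero]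
  refine h _ ?_
  simpa using ((isHomogeneous_eval_genericHol y).pow a).mul ((isHomogeneous_eval_genericAnti y).pow b)

/-- The Laplacian in `z` turns into multiplication by `|X|²` under `ℓ`.  Hence `dualPoly ℓ a b` is
harmonic as soon as `ℓ` annihilates the multiples of `|X|²`. -/
lemma laplacian_dualPoly (ℓ : BiPoly n →ₗ[ℂ] ℂ) (a b : ℕ) :
    laplacian (dualPoly ℓ a b) =
      4 * ((a : BiPoly n) * ((b : BiPoly n) *
        dualPoly (ℓ ∘ₗ LinearMap.mulLeft ℂ (normSqPoly n)) (a - 1) (b - 1))) := by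
  rw [laplacian, dualPoly, dualPoly]
  simp only [mapCoeff_pderiv]
  rw [← mapCoeff_sum, ← mapCoeff_C_mul, ← mapCoeff_natCast_mul, ← mapCoeff_natCast_mul]
  congr 2
  simp only [Derivation.leibniz, Derivation.leibniz_pow, pderiv_inl_genericHol,
    pderiv_inr_genericHol, pderiv_inl_genericAnti, pderiv_inr_genericAnti, smul_zero, add_zero,
    smul_eq_mul, nsmul_eq_mul, pderiv_C, mul_zero, zero_add, Derivation.map_natCast]
  simp only [normSqPoly, map_sum, map_mul, Finset.mul_sum, Finset.sum_mul]
  refine Finset.sum_congr rfl fun j _ => ?_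
  ring

lemma isWeightedHomogeneous_genericHol (w : Fin n ⊕ Fin n → ℕ) (c : ℕ)
    (hw : ∀ j, w (Sum.inl j) = c) : IsWeightedHomogeneous w (genericHol n) c :=
  IsWeightedHomogeneous.sum _ _ _ fun j _ => by
    simpa [hw] using (isWeightedHomogeneous_C w (X (Sum.inr j) : BiPoly n)).mul
      (isWeightedHomogeneous_X (BiPoly n) w (Sum.inl j))

lemma isWeightedHomogeneous_genericAnti (w : Fin n ⊕ Fin n → ℕ) (c : ℕ)
    (hw : ∀ j, w (Sum.inr j) = c) : IsWeightedHomogeneous w (genericAnti n) c :=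
  IsWeightedHomogeneous.sum _ _ _ fun j _ => by
    simpa [hw] using (isWeightedHomogeneous_C w (X (Sum.inl j) : BiPoly n)).mul
      (isWeightedHomogeneous_X (BiPoly n) w (Sum.inr j))

lemma bidegree_dualPoly (ℓ : BiPoly n →ₗ[ℂ] ℂ) (a b : ℕ) (d : Fin n ⊕ Fin n →₀ ℕ)
    (hd : d ∈ (dualPoly ℓ a b).support) :
    ∑ j, d (Sum.inl j) = a ∧ ∑ j, d (Sum.inr j) = b := by
  have hne : (genericHol n ^ a * genericAnti n ^ b).coeff d ≠ 0 := by
    intro h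
    simp [dualPoly, h] at hd
  have key : ∀ c e : ℕ, Finsupp.weight (Sum.elim (fun _ : Fin n => c) (fun _ : Fin n => e)) d =
      a • c + b • e := fun c e =>
    (((isWeightedHomogeneous_genericHol (Sum.elim (fun _ => c) fun _ => e) c fun _ => rfl).pow a).mul
      ((isWeightedHomogeneous_genericAnti (Sum.elim (fun _ => c) fun _ => e) e
        fun _ => rfl).pow b)) hne
  have h1 := key 1 0
  have h2 := key 0 1
  simp [Finsupp.weight_apply, Finsupp.sum_fintype] at h1 h2
  exact ⟨h1, h2⟩

/-- A functional is determined on the homogeneous polynomials of degree `k` by its values on the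
`k`-th powers of linear forms. -/
lemma eq_zero_of_mapCoeff_pow_eq_zero (k : ℕ) :
    ∀ ℓ : BiPoly n →ₗ[ℂ] ℂ, mapCoeff ℓ ((genericHol n + genericAnti n) ^ k) = 0 →
      ∀ P : BiPoly n, P.IsHomogeneous k → ℓ P = 0 := by
  induction k with
  | zero =>
    intro ℓ h P hP
    have h1 : ℓ 1 = 0 := by
      have := congrArg (coeff 0) h
      simpa using this
    obtain ⟨c, rfl⟩ : ∃ c, P = C c := ⟨_, (totalDegree_eq_zero_iff_eq_C.1
      (Nat.le_zero.1 hP.totalDegree_le))⟩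
    rw [← mul_one (C c), ← smul_eq_C_mul, map_smul, h1, smul_zero]
  | succ k ih =>
    intro ℓ h P hP
    -- A derivative in the outer variable dual to `X_s` replaces `ℓ` by `ℓ (X_s ·)` and lowers `k`.
    have hX : ∀ s (Q : BiPoly n), Q.IsHomogeneous k → ℓ (X s * Q) = 0 := by
      intro s
      have h2 : mapCoeff (ℓ ∘ₗ LinearMap.mulLeft ℂ (X s))
          ((genericHol n + genericAnti n) ^ k) = 0 := by
        obtain ⟨s', hs'⟩ : ∃ s', pderiv s' (genericHol n + genericAnti n) = C (X s) := by
          rcases s with j | j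
          · exact ⟨Sum.inr j, by simp [pderiv_inr_genericHol, pderiv_inr_genericAnti]⟩
          · exact ⟨Sum.inl j, by simp [pderiv_inl_genericHol, pderiv_inl_genericAnti]⟩
        have h3 := congrArg (pderiv s') h
        rw [mapCoeff_pderiv, map_zero, Derivation.leibniz_pow, hs', nsmul_eq_mul,
          mapCoeff_natCast_mul, smul_eq_mul, mul_comm (_ ^ _), mapCoeff_C_mul,
          Nat.add_sub_cancel] at h3
        exact (mul_eq_zero.1 h3).resolve_left (Nat.cast_ne_zero.2 (Nat.succ_ne_zero k))
      exact fun Q hQ => ih _ h2 Q hQ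
    rw [P.as_sum, map_sum]
    refine Finset.sum_eq_zero fun d hd => ?_
    have hdeg : d.degree = k + 1 := by
      have := hP (mem_support_iff.1 hd)
      rw [Finsupp.degree_eq_weight_one]
      exact this
    obtain ⟨s, hs⟩ : ∃ s, d s ≠ 0 := by
      by_contra! hall
      have : d = 0 := Finsupp.ext hall
      simp [this] at hdeg
    have hd' : d = Finsupp.single s 1 + (d - Finsupp.single s 1) := by
      rw [add_tsub_cancel_of_le]
      simpa [Finsupp.single_le_iff] using Nat.one_le_iff_ne_zero.2 hs
    rw [hd', ← one_mul (coeff _ P), ← monomial_mul]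
    refine hX s _ (isHomogeneous_monomial _ ?_)
    have := congrArg Finsupp.degree hd'
    simp only [map_add, Finsupp.degree_single] at this
    omega

/-- If `∑ a, x_a c^a c̄^(k-a)` vanishes for all unimodular `c`, then so do the coefficients `x_a`:
multiplied by `c^k`, the sum is a polynomial in `c²`. -/
lemma eq_zero_of_forall_unimodular (k : ℕ) (x : ℕ → ℂ)
    (h : ∀ c : ℂ, ‖c‖ = 1 →
      ∑ a ∈ Finset.range (k + 1), c ^ a * (starRingEnd ℂ c) ^ (k - a) * x a = 0) :
    ∀ a ≤ k, x a = 0 := by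
  set q : Polynomial ℂ := ∑ a ∈ Finset.range (k + 1), Polynomial.monomial a (x a) with hq
  have hroot : ∀ w : ℂ, ‖w‖ = 1 → q.IsRoot w := by
    intro w hw
    obtain ⟨c, hc⟩ : ∃ c : ℂ, c ^ 2 = w := IsAlgClosed.exists_pow_nat_eq w (by norm_num)
    have hc1 : ‖c‖ = 1 := by
      have : ‖c‖ ^ 2 = 1 := by rw [← norm_pow, hc, hw]
      exact (pow_eq_one_iff_of_nonneg (norm_nonneg _) (by norm_num)).1 this
    have hcc : starRingEnd ℂ c * c = 1 := by
      rw [mul_comm, Complex.mul_conj, Complex.normSq_eq_norm_sq, hc1]; simp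
    have := congrArg (fun y => c ^ k * y) (h c hc1)
    simp only [mul_zero, Finset.mul_sum] at this
    rw [Polynomial.IsRoot, hq, Polynomial.eval_finsetSum, ← this]
    refine Finset.sum_congr rfl fun a ha => ?_
    have hak : a ≤ k := Nat.lt_succ_iff.1 (Finset.mem_range.1 ha)
    have hck : c ^ k = c ^ a * c ^ (k - a) := by rw [← pow_add]; congr 1; omega
    rw [Polynomial.eval_monomial, ← hc, hck]
    calc x a * (c ^ 2) ^ a = c ^ a * c ^ a * (starRingEnd ℂ c * c) ^ (k - a) * x a := by
          rw [hcc]; ring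
      _ = _ := by rw [mul_pow]; ring
  have hinf : Set.Infinite {w : ℂ | q.IsRoot w} := by
    refine Set.Infinite.mono (s := Metric.sphere (0 : ℂ) 1) (fun w hw => hroot w (by simpa using hw))
      ?_
    refine (isPreconnected_sphere (by simp [Complex.rank_real_complex]) (0 : ℂ)
      1).infinite_of_nontrivial ⟨1, by simp, -1, by simp, ?_⟩
    norm_num
  have hq0 : q = 0 := Polynomial.eq_zero_of_infinite_isRoot q hinf
  intro a ha
  have := congrArg (fun p => Polynomial.coeff p a) hq0
  simpa [hq, Polynomial.finsetSum_coeff, Polynomial.coeff_monomial, Nat.lt_succ_iff, ha] using this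

/-- The duality form of non-harmonicity: modulo multiples of `|u|²`, the homogeneous polynomials of
degree `k` are spanned by the powers `⟨u, z⟩ ^ k` with `z ∈ K`.  A functional that
annihilates the right-hand side gives, through `dualPoly`, bi-graded harmonic polynomials that vanish
on `K`. -/
theorem homogeneous_mem_span {K : Set (Cn n)} (hK : IsComplexCone K) (hKharm : IsNonHarmonic K)
    (k : ℕ) (P : BiPoly n) (hP : P.IsHomogeneous k) :
    P ∈ Submodule.span ℂ ({Q | ∃ z ∈ K, Q = (antiPoly z + holPoly z) ^ k} ∪
      {Q | ∃ P' : BiPoly n, ∃ i, i + 2 = k ∧ P'.IsHomogeneous i ∧ Q = normSqPoly n * P'}) := by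
  by_contra hmem
  obtain ⟨ℓ, hℓP, hℓ⟩ := Submodule.exists_le_ker_of_notMem hmem
  refine hℓP (eq_zero_of_mapCoeff_pow_eq_zero k ℓ ?_ P hP)
  have hlin : ∀ z ∈ K, ℓ ((antiPoly z + holPoly z) ^ k) = 0 := fun z hz =>
    hℓ (Submodule.subset_span (Or.inl ⟨z, hz, rfl⟩))
  have hN : ∀ P' : BiPoly n, ∀ i, i + 2 = k → P'.IsHomogeneous i → ℓ (normSqPoly n * P') = 0 :=
    fun P' i hi hP' => hℓ (Submodule.subset_span (Or.inr ⟨P', i, hi, hP', rfl⟩))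
  have hzero : ∀ a b, a + b = k → dualPoly ℓ a b = 0 := by
    intro a b hab
    by_contra hne
    obtain ⟨z, hz, hz0⟩ := hKharm a b (dualPoly ℓ a b) ⟨bidegree_dualPoly ℓ a b, by
      rw [laplacian_dualPoly]
      rcases Nat.eq_zero_or_pos a with rfl | ha
      · simp
      rcases Nat.eq_zero_or_pos b with rfl | hb
      · simp
      rw [dualPoly_eq_zero fun P' hP' => hN P' _ (by omega) hP']
      simp⟩ hne
    refine hz0 ?_
    -- The rotations `c • z` stay in `K`, and they separate the bidegrees.
    have key := eq_zero_of_forall_unimodular k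
      (fun i => (k.choose i : ℂ) * ℓ (antiPoly z ^ i * holPoly z ^ (k - i))) (fun c _ => by
        rw [← hlin (c • z) (hK z hz c), add_pow, map_sum]
        refine Finset.sum_congr rfl fun i _ => ?_
        have h1 : antiPoly (c • z) = c • antiPoly z := by
          simp [antiPoly, Finset.smul_sum, smul_eq_C_mul, mul_assoc]
        have h2 : holPoly (c • z) = (starRingEnd ℂ c) • holPoly z := by
          simp [holPoly, Finset.smul_sum, smul_eq_C_mul, mul_assoc]
        have h3 : ∀ (N : ℕ) (s : ℂ) (Q : BiPoly n), s • Q * (N : BiPoly n) = (s * N) • Q := by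
          intro N s Q
          rw [mul_comm, ← nsmul_eq_mul, ← Nat.cast_smul_eq_nsmul ℂ, smul_smul, mul_comm]
        rw [h1, h2, smul_pow, smul_pow, smul_mul_smul_comm, h3, map_smul, smul_eq_mul,
          mul_assoc _ (k.choose i : ℂ)]) a (by omega)
    rw [evalAt_dualPoly]
    have hb : b = k - a := by omega
    subst hb
    exact (mul_eq_zero.1 key).resolve_left
      (Nat.cast_ne_zero.2 (Nat.choose_pos (by omega)).ne')
  rw [add_pow, mapCoeff_sum]
  refine Finset.sum_eq_zero fun i hi => ?_
  rw [mul_comm, mapCoeff_natCast_mul]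
  have := hzero i (k - i) (by have := Finset.mem_range.1 hi; omega)
  rw [dualPoly] at this
  rw [this, mul_zero]

/-! ### Truncated moments -/

@[simp]
lemma evalAt_add (P Q : BiPoly n) (z : Cn n) : evalAt (P + Q) z = evalAt P z + evalAt Q z := by
  simp [evalAt]

@[simp]
lemma evalAt_mul (P Q : BiPoly n) (z : Cn n) : evalAt (P * Q) z = evalAt P z * evalAt Q z := by
  simp [evalAt]

@[simp]
lemma evalAt_smul (c : ℂ) (P : BiPoly n) (z : Cn n) : evalAt (c • P) z = c * evalAt P z := by
  simp [evalAt]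

lemma continuous_evalAt (P : BiPoly n) : Continuous (evalAt P) := by
  refine (MvPolynomial.continuous_eval P).comp (continuous_pi fun s => ?_)
  rcases s with j | j
  · exact (EuclideanSpace.proj j : Cn n →L[ℂ] ℂ).continuous
  · exact Complex.continuous_conj.comp (EuclideanSpace.proj j : Cn n →L[ℂ] ℂ).continuous

lemma evalAt_normSqPoly (z : Cn n) : evalAt (normSqPoly n) z = ((‖z‖ ^ 2 : ℝ) : ℂ) := by
  rw [EuclideanSpace.norm_sq_eq]
  simp [evalAt, normSqPoly, Complex.mul_conj, Complex.normSq_eq_norm_sq]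

/-- The conjugate of a polynomial in `z, z̄` is again one. -/
lemma exists_evalAt_eq_conj (P : BiPoly n) :
    ∃ P' : BiPoly n, ∀ z, evalAt P' z = (starRingEnd ℂ) (evalAt P z) := by
  induction P using MvPolynomial.induction_on with
  | C a => exact ⟨C ((starRingEnd ℂ) a), fun z => by simp [evalAt]⟩
  | add p q hp hq =>
    obtain ⟨p', hp'⟩ := hp
    obtain ⟨q', hq'⟩ := hq
    exact ⟨p' + q', fun z => by simp [hp', hq']⟩
  | mul_X p s hp =>
    obtain ⟨p', hp'⟩ := hp
    refine ⟨p' * X s.swap, fun z => ?_⟩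
    rcases s with j | j <;> simp [hp'] <;> simp [evalAt]

lemma continuous_truncation (R : ℝ) (m : ℕ) :
    Continuous fun u : Cn n => (max (R - ‖u‖ ^ 2) 0) ^ m := by
  fun_prop

lemma truncation_eq_zero {R : ℝ} {m : ℕ} {u : Cn n}
    (hu : u ∉ Metric.closedBall (0 : Cn n) (|R| + 1)) :
    (max (R - ‖u‖ ^ 2) 0) ^ (m + 1) = 0 := by
  have h1 : |R| + 1 < ‖u‖ := by simpa using hu
  have h2 : R ≤ ‖u‖ ^ 2 := by nlinarith [le_abs_self R, abs_nonneg R]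
  rw [max_eq_right (by linarith), zero_pow (Nat.succ_ne_zero m)]

lemma hasCompactSupport_truncation (R : ℝ) (m : ℕ) :
    HasCompactSupport fun u : Cn n => (max (R - ‖u‖ ^ 2) 0) ^ (m + 1) :=
  HasCompactSupport.intro (isCompact_closedBall _ _) fun _ hu => truncation_eq_zero hu

/-- The moment `∫ f(u) (R - |u|²)_+^m P(u) du`.  Up to a factor it is the `m`-fold integral in `R` of
the moment of `f` over the ball `|u|² < R`. -/
def truncMoment (f : Cn n → ℂ) (m : ℕ) (R : ℝ) (P : BiPoly n) : ℂ :=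
  ∫ u, f u * (((max (R - ‖u‖ ^ 2) 0) ^ m : ℝ) : ℂ) * evalAt P u

section truncMoment

variable {f : Cn n → ℂ} (hf : Continuous f)

include hf

lemma integrable_mul_truncation (R : ℝ) (m : ℕ) :
    Integrable fun u => f u * (((max (R - ‖u‖ ^ 2) 0) ^ (m + 1) : ℝ) : ℂ) := by
  refine Continuous.integrable_of_hasCompactSupport
    (hf.mul (Complex.continuous_ofReal.comp (continuous_truncation R _))) ?_
  refine HasCompactSupport.intro (isCompact_closedBall 0 (|R| + 1)) fun u hu => ?_
  rw [truncation_eq_zero hu, Complex.ofReal_zero, mul_zero]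

lemma integrable_truncMoment (R : ℝ) (m : ℕ) (P : BiPoly n) :
    Integrable fun u => f u * (((max (R - ‖u‖ ^ 2) 0) ^ (m + 1) : ℝ) : ℂ) * evalAt P u := by
  refine (integrable_mul_truncation (hf.mul (continuous_evalAt P)) R m).congr
    (Filter.Eventually.of_forall fun u => ?_)
  simp only [Pi.mul_apply]
  ring

lemma truncMoment_add (m : ℕ) (R : ℝ) (P Q : BiPoly n) :
    truncMoment f (m + 1) R (P + Q) = truncMoment f (m + 1) R P + truncMoment f (m + 1) R Q := by
  rw [truncMoment, truncMoment, truncMoment, ← integral_add (integrable_truncMoment hf R m P)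
    (integrable_truncMoment hf R m Q)]
  simp only [evalAt_add, mul_add]

omit hf in
lemma truncMoment_smul (m : ℕ) (R : ℝ) (c : ℂ) (P : BiPoly n) :
    truncMoment f m R (c • P) = c * truncMoment f m R P := by
  rw [truncMoment, truncMoment, ← integral_const_mul]
  simp only [evalAt_smul]
  congr 1; ext u; ring

omit hf in
lemma truncMoment_zero (m : ℕ) (R : ℝ) : truncMoment f m R 0 = 0 := by
  simpa using truncMoment_smul (f := f) m R 0 0

lemma truncMoment_sum {ι : Type*} (s : Finset ι) (m : ℕ) (R : ℝ) (P : ι → BiPoly n) :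
    truncMoment f (m + 1) R (∑ i ∈ s, P i) = ∑ i ∈ s, truncMoment f (m + 1) R (P i) := by
  classical
  induction s using Finset.induction_on with
  | empty => simp [truncMoment_zero]
  | insert a s ha ih => rw [Finset.sum_insert ha, Finset.sum_insert ha, truncMoment_add hf, ih]

omit hf in
lemma truncMoment_radius_zero (m : ℕ) (P : BiPoly n) : truncMoment f (m + 1) 0 P = 0 := by
  simp [truncMoment]

/-- Multiplication by `|u|² = R - (R - |u|²)` raises the order of the truncation. -/
lemma truncMoment_normSqPoly_mul (m : ℕ) (R : ℝ) (P : BiPoly n) :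
    truncMoment f (m + 1) R (normSqPoly n * P) =
      R * truncMoment f (m + 1) R P - truncMoment f (m + 2) R P := by
  rw [truncMoment, truncMoment, truncMoment, ← integral_const_mul,
    ← integral_sub ((integrable_truncMoment hf R m P).const_mul _)
      (integrable_truncMoment hf R (m + 1) P)]
  congr 1; ext u
  have h : ‖u‖ ^ 2 * (max (R - ‖u‖ ^ 2) 0) ^ (m + 1) =
      R * (max (R - ‖u‖ ^ 2) 0) ^ (m + 1) - (max (R - ‖u‖ ^ 2) 0) ^ (m + 2) := by
    rcases le_total (R - ‖u‖ ^ 2) 0 with h0 | h0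
    · simp [max_eq_right h0]
    · rw [max_eq_left h0]; ring
  have h' := congrArg (fun x : ℝ => (x : ℂ)) h
  simp only [Complex.ofReal_mul, Complex.ofReal_sub] at h'
  rw [evalAt_mul, evalAt_normSqPoly]
  linear_combination (f u * evalAt P u) * h'

omit hf in
lemma hasDerivAt_max_zero_pow (m : ℕ) (x : ℝ) :
    HasDerivAt (fun x : ℝ => (max x 0) ^ (m + 2)) ((m + 2 : ℝ) * (max x 0) ^ (m + 1)) x := by
  rcases lt_trichotomy x 0 with hx | hx | hx
  · have h : (fun x : ℝ => (max x 0) ^ (m + 2)) =ᶠ[nhds x] fun _ => 0 := by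
      filter_upwards [Iio_mem_nhds hx] with y hy
      simp [max_eq_right (le_of_lt (Set.mem_Iio.1 hy))]
    rw [max_eq_right hx.le, zero_pow (Nat.succ_ne_zero m), mul_zero]
    exact (hasDerivAt_const x (0 : ℝ)).congr_of_eventuallyEq h
  · subst hx
    rw [max_self, zero_pow (Nat.succ_ne_zero m), mul_zero, hasDerivAt_iff_isLittleO]
    simp only [max_self, sub_zero, smul_zero, zero_pow (Nat.succ_ne_zero (m + 1))]
    have h1 : (fun x : ℝ => (max x 0) ^ (m + 2)) =O[nhds 0] fun x => x ^ (m + 2) := by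
      refine Asymptotics.IsBigO.of_bound 1 (Filter.Eventually.of_forall fun y => ?_)
      rw [one_mul, norm_pow, norm_pow]
      gcongr
      rw [Real.norm_eq_abs, Real.norm_eq_abs, abs_of_nonneg (le_max_right _ _)]
      exact max_le (le_abs_self _) (abs_nonneg _)
    refine h1.trans_isLittleO ?_
    simpa using! Asymptotics.isLittleO_pow_pow (𝕜 := ℝ) (m := 1) (n := m + 2) (by omega)
  · have h : (fun x : ℝ => (max x 0) ^ (m + 2)) =ᶠ[nhds x] fun x => x ^ (m + 2) := by
      filter_upwards [Ioi_mem_nhds hx] with y hy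
      rw [max_eq_left (le_of_lt (Set.mem_Ioi.1 hy))]
    rw [max_eq_left hx.le]
    have := (hasDerivAt_pow (m + 2) x).congr_of_eventuallyEq h
    simpa using this

lemma hasDerivAt_truncMoment (m : ℕ) (R : ℝ) (P : BiPoly n) :
    HasDerivAt (fun R => truncMoment f (m + 2) R P)
      ((m + 2 : ℂ) * truncMoment f (m + 1) R P) R := by
  have hint := fun m R => integrable_truncMoment hf R m P
  have key := hasDerivAt_integral_of_dominated_loc_of_deriv_le
    (F := fun R u => f u * (((max (R - ‖u‖ ^ 2) 0) ^ (m + 2) : ℝ) : ℂ) * evalAt P u)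
    (F' := fun R u => (m + 2 : ℂ) *
      (f u * (((max (R - ‖u‖ ^ 2) 0) ^ (m + 1) : ℝ) : ℂ) * evalAt P u))
    (bound := fun u => ‖(m + 2 : ℂ) *
      (f u * (((max (R + 1 - ‖u‖ ^ 2) 0) ^ (m + 1) : ℝ) : ℂ) * evalAt P u)‖)
    (Metric.ball_mem_nhds R one_pos)
    (Filter.Eventually.of_forall fun x => (hint (m + 1) x).aestronglyMeasurable)
    (hint (m + 1) R) ((hint m R).const_mul _).aestronglyMeasurable
    (Filter.Eventually.of_forall fun u x hx => ?_) ((hint m (R + 1)).const_mul _).norm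
    (Filter.Eventually.of_forall fun u x _ => ?_)
  · rw [truncMoment, ← integral_const_mul]
    exact key.2
  · have hxR : x ≤ R + 1 := by
      have := (abs_lt.1 (by simpa [Real.dist_eq] using hx : |x - R| < 1)).2
      linarith
    simp only [norm_mul, Complex.norm_real, norm_pow]
    have : ‖max (x - ‖u‖ ^ 2) 0‖ ≤ ‖max (R + 1 - ‖u‖ ^ 2) 0‖ := by
      rw [Real.norm_of_nonneg (le_max_right _ _), Real.norm_of_nonneg (le_max_right _ _)]
      gcongr
    gcongr
  · have h1 := ((hasDerivAt_max_zero_pow m (x - ‖u‖ ^ 2)).comp x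
      ((hasDerivAt_id x).sub_const (‖u‖ ^ 2))).ofReal_comp
    have h2 := (h1.const_mul (f u)).mul_const (evalAt P u)
    refine h2.congr_deriv ?_
    push_cast
    ring

lemma truncMoment_two_eq_zero {P : BiPoly n} (h : ∀ R, truncMoment f 1 R P = 0) (R : ℝ) :
    truncMoment f 2 R P = 0 := by
  have hd : ∀ x, HasDerivAt (fun R => truncMoment f 2 R P) 0 x := fun x => by
    simpa [h] using hasDerivAt_truncMoment hf 0 x P
  have := is_const_of_deriv_eq_zero (fun x => (hd x).differentiableAt) (fun x => (hd x).deriv) R 0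
  simpa [truncMoment_radius_zero] using this

omit hf in
/-- A solution of a linear system with constant coefficients that starts at `0` vanishes. -/
lemma eq_zero_of_linear_system {ι : Type*} [Fintype ι] (Y : ι → ℝ → ℂ) (a : ι → ι → ℂ)
    (hY : ∀ i R, HasDerivAt (Y i) (∑ j, a i j * Y j R) R) (h0 : ∀ i, Y i 0 = 0) :
    ∀ i R, Y i R = 0 := by
  classical
  set L : (ι → ℂ) →L[ℂ] (ι → ℂ) := LinearMap.toContinuousLinearMap (Matrix.mulVecLin (Matrix.of a))
  have h := ODE_solution_unique_univ (v := fun _ => L) (s := fun _ => Set.univ) (K := ‖L‖₊)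
    (f := fun R i => Y i R) (g := fun _ => 0) (t₀ := 0) (fun _ => L.lipschitz.lipschitzOnWith)
    (fun R => ⟨hasDerivAt_pi.2 fun i => by
      simpa [L, Matrix.mulVec, dotProduct] using hY i R, trivial⟩)
    (fun R => ⟨by simpa using hasDerivAt_const R (0 : ι → ℂ), trivial⟩) (funext h0)
  exact fun i R => congrFun (congrFun h R) i

/-- If, on a finite-dimensional space `W` of polynomials, each first moment is a sum of moments of
higher order, then all of them vanish: the moments of orders `2, …, k + 1` form a solution of a
linear system of differential equations in `R` that starts at `0`. -/
lemma truncMoment_eq_zero_of_reduction {W : Submodule ℂ (BiPoly n)} (hW : W.FG) (k : ℕ)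
    (h : ∀ P ∈ W, ∃ Q : Fin k → BiPoly n, (∀ b, Q b ∈ W) ∧
      ∀ R, truncMoment f 1 R P = ∑ b : Fin k, truncMoment f (b + 2) R (Q b)) :
    ∀ P ∈ W, ∀ R, truncMoment f 1 R P = 0 := by
  classical
  obtain ⟨t, rfl⟩ := hW
  have hspan : ∀ P ∈ Submodule.span ℂ (t : Set (BiPoly n)), ∃ c : t → ℂ,
      ∀ m R, truncMoment f (m + 1) R P = ∑ i : t, c i * truncMoment f (m + 1) R i := by
    intro P hP
    rw [← Subtype.range_coe (s := (t : Set (BiPoly n)))] at hP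
    obtain ⟨c, rfl⟩ := Submodule.mem_span_range_iff_exists_fun ℂ |>.1 hP
    exact ⟨c, fun m R => by rw [truncMoment_sum hf]; simp [truncMoment_smul]⟩
  have hred : ∀ P ∈ Submodule.span ℂ (t : Set (BiPoly n)), ∃ c : Fin k × t → ℂ,
      ∀ R, truncMoment f 1 R P = ∑ p : Fin k × t, c p * truncMoment f (p.1 + 2) R p.2 := by
    intro P hP
    obtain ⟨Q, hQ, hPQ⟩ := h P hP
    choose c hc using fun b => hspan (Q b) (hQ b)
    refine ⟨fun p => c p.1 p.2, fun R => ?_⟩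
    rw [hPQ, Fintype.sum_prod_type]
    exact Finset.sum_congr rfl fun b _ => hc b (b + 1) R
  have hsys : ∀ p : Fin k × t, ∃ a : Fin k × t → ℂ, ∀ R,
      HasDerivAt (fun R => truncMoment f (p.1 + 2) R p.2)
        (∑ q, a q * truncMoment f (q.1 + 2) R q.2) R := by
    rintro ⟨⟨b, hb⟩, i⟩
    rcases b with _ | b
    -- The derivative of a second moment is a first moment, where the reduction applies.
    · obtain ⟨c, hc⟩ := hred i (Submodule.subset_span i.2)
      refine ⟨fun q => 2 * c q, fun R => ?_⟩
      have := hasDerivAt_truncMoment hf 0 R i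
      rw [hc R, Finset.mul_sum] at this
      simpa [mul_assoc] using this
    · refine ⟨Pi.single (⟨b, by omega⟩, i) (b + 3 : ℂ), fun R => ?_⟩
      have := hasDerivAt_truncMoment hf (b + 1) R i
      rw [Finset.sum_eq_single (⟨b, by omega⟩, i) (fun q _ hq => by simp [Pi.single_eq_of_ne hq])
        (by simp)]
      simp only [Pi.single_eq_same]
      convert this using 2
      push_cast; ring
  choose a ha using hsys
  have hzero := eq_zero_of_linear_system
    (fun (p : Fin k × t) R => truncMoment f (p.1 + 2) R p.2) a ha
    (fun p => truncMoment_radius_zero _ _)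
  intro P hP R
  obtain ⟨c, hc⟩ := hred P hP
  rw [hc R]
  exact Finset.sum_eq_zero fun p _ => by rw [hzero p R, mul_zero]

/-- A continuous function all of whose moments vanish is zero, by the Stone–Weierstrass theorem. -/
lemma eq_zero_of_truncMoment_eq_zero (h : ∀ P R, truncMoment f 1 R P = 0) : f = 0 := by
  by_contra hne
  obtain ⟨u₀, hu₀⟩ : ∃ u₀, f u₀ ≠ 0 := by
    by_contra! hall
    exact hne (funext hall)
  set R : ℝ := ‖u₀‖ ^ 2 + 1 with hR
  set B : Set (Cn n) := Metric.closedBall 0 (|R| + 1) with hB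
  have hBc : CompactSpace B := isCompact_iff_compactSpace.1 (isCompact_closedBall _ _)
  set χ : Cn n → ℝ := fun u => (max (R - ‖u‖ ^ 2) 0) ^ (0 + 1) with hχ
  have hχ0 : ∀ u, 0 ≤ χ u := fun u => pow_nonneg (le_max_right _ _) _
  set restr : BiPoly n → C(B, ℂ) := fun P => ⟨fun u => evalAt P u,
    (continuous_evalAt P).comp continuous_subtype_val⟩ with hrestr
  let A : StarSubalgebra ℂ C(B, ℂ) :=
    { carrier := Set.range restr
      mul_mem' := by
        rintro _ _ ⟨P, rfl⟩ ⟨Q, rfl⟩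
        exact ⟨P * Q, by ext u; simp [restr]⟩
      add_mem' := by
        rintro _ _ ⟨P, rfl⟩ ⟨Q, rfl⟩
        exact ⟨P + Q, by ext u; simp [restr]⟩
      algebraMap_mem' := fun c => ⟨C c, by ext u; simp [restr, evalAt]⟩
      star_mem' := by
        rintro _ ⟨P, rfl⟩
        obtain ⟨P', hP'⟩ := exists_evalAt_eq_conj P
        exact ⟨P', by ext u; simp [restr, hP']⟩ }
  have hsep : A.SeparatesPoints := by
    intro x y hxy
    obtain ⟨j, hj⟩ : ∃ j, (x : Cn n) j ≠ (y : Cn n) j := by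
      by_contra! hall
      exact hxy (Subtype.ext (PiLp.ext hall))
    exact ⟨restr (X (Sum.inl j)), ⟨_, ⟨_, rfl⟩, rfl⟩, by simpa [restr, evalAt] using hj⟩
  have hdense := ContinuousMap.starSubalgebra_topologicalClosure_eq_top_of_separatesPoints A hsep
  set g : C(B, ℂ) := ⟨fun u => (starRingEnd ℂ) (f u),
    Complex.continuous_conj.comp (hf.comp continuous_subtype_val)⟩ with hg
  have hgmem : g ∈ closure (A : Set C(B, ℂ)) := by
    have : g ∈ A.topologicalClosure := by rw [hdense]; trivial
    exact this
  have hint : Integrable fun u => f u * ((χ u : ℝ) : ℂ) := integrable_mul_truncation hf R 0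
  have hcont : Continuous fun u => ‖f u‖ ^ 2 * χ u := by fun_prop
  have hsupp : HasCompactSupport fun u => ‖f u‖ ^ 2 * χ u :=
    (hasCompactSupport_truncation R 0).mul_left
  have hpos : 0 < ∫ u, ‖f u‖ ^ 2 * χ u := by
    refine hcont.integral_pos_of_hasCompactSupport_nonneg_nonzero hsupp
      (fun u => mul_nonneg (sq_nonneg _) (hχ0 u)) (x := u₀) ?_
    have : χ u₀ = 1 := by simp [hχ, hR]
    simpa [this] using hu₀
  -- Approximate `conj f` by polynomials on the support of the weight `χ`.
  have hle : ∀ ε > 0, ∫ u, ‖f u‖ ^ 2 * χ u ≤ ε * ∫ u, ‖f u * ((χ u : ℝ) : ℂ)‖ := by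
    intro ε hε
    obtain ⟨_, ⟨P, rfl⟩, hP⟩ := Metric.mem_closure_iff.1 hgmem ε hε
    have hclose : ∀ u ∈ B, ‖(starRingEnd ℂ) (f u) - evalAt P u‖ ≤ ε := by
      intro u hu
      have := (ContinuousMap.dist_lt_iff hε).1 hP ⟨u, hu⟩
      rw [dist_eq_norm] at this
      exact this.le
    have h0 : ∫ u, f u * ((χ u : ℝ) : ℂ) * evalAt P u = 0 := h P R
    have hintP : Integrable fun u => f u * ((χ u : ℝ) : ℂ) * evalAt P u :=
      integrable_truncMoment hf R 0 P
    have hsq : ∀ u, f u * ((χ u : ℝ) : ℂ) * (starRingEnd ℂ) (f u) =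
        ((‖f u‖ ^ 2 * χ u : ℝ) : ℂ) := by
      intro u
      rw [mul_right_comm, Complex.mul_conj, Complex.normSq_eq_norm_sq]
      push_cast; ring
    have hintR : Integrable fun u => ((‖f u‖ ^ 2 * χ u : ℝ) : ℂ) :=
      (hcont.integrable_of_hasCompactSupport (μ := volume) hsupp).ofReal
    have heq : ((∫ u, ‖f u‖ ^ 2 * χ u : ℝ) : ℂ) =
        ∫ u, f u * ((χ u : ℝ) : ℂ) * ((starRingEnd ℂ) (f u) - evalAt P u) := by
      rw [← integral_complex_ofReal]
      have : (∫ u, ((‖f u‖ ^ 2 * χ u : ℝ) : ℂ)) =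
          (∫ u, ((‖f u‖ ^ 2 * χ u : ℝ) : ℂ)) - ∫ u, f u * ((χ u : ℝ) : ℂ) * evalAt P u := by
        rw [h0, sub_zero]
      rw [this, ← integral_sub hintR hintP]
      congr 1; ext u
      rw [← hsq u]; ring
    calc ∫ u, ‖f u‖ ^ 2 * χ u ≤ ‖((∫ u, ‖f u‖ ^ 2 * χ u : ℝ) : ℂ)‖ := by
          rw [Complex.norm_real]; exact le_abs_self _
      _ ≤ ∫ u, ε * ‖f u * ((χ u : ℝ) : ℂ)‖ := by
          rw [heq]
          refine norm_integral_le_of_norm_le (hint.norm.const_mul ε)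
            (Filter.Eventually.of_forall fun u => ?_)
          rw [norm_mul, mul_comm]
          by_cases hu : u ∈ B
          · gcongr; exact hclose u hu
          · have : χ u = 0 := truncation_eq_zero hu
            simp [this]
      _ = _ := integral_const_mul _ _
  set I := ∫ u, ‖f u * ((χ u : ℝ) : ℂ)‖ with hI
  have hI0 : 0 ≤ I := integral_nonneg fun _ => norm_nonneg _
  have := hle ((∫ u, ‖f u‖ ^ 2 * χ u) / (I + 1) / 2) (by positivity)
  have h2 : (∫ u, ‖f u‖ ^ 2 * χ u) / (I + 1) / 2 * I < ∫ u, ‖f u‖ ^ 2 * χ u := by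
    rw [div_div, div_mul_eq_mul_div, div_lt_iff₀ (by positivity)]
    nlinarith
  linarith

end truncMoment

/-! ### Taylor expansion of twisted integrals -/

/-- A polynomial that is `O(t ^ N)` as `t → 0+` has no terms of degree less than `N`. -/
lemma coeff_eq_zero_of_norm_eval_le (N : ℕ) : ∀ (q : Polynomial ℂ) (c : ℝ),
    (∀ t : ℝ, 0 < t → t ≤ 1 → ‖q.eval (t : ℂ)‖ ≤ c * t ^ N) → ∀ m < N, q.coeff m = 0 := by
  induction N with
  | zero => intro q c _ m hm; omega
  | succ N ih =>
    intro q c hq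
    have h0 : q.coeff 0 = 0 := by
      have h1 : Filter.Tendsto (fun t : ℝ => ‖q.eval (t : ℂ)‖) (nhdsWithin 0 (Set.Ioi 0))
          (nhds ‖q.eval ((0 : ℝ) : ℂ)‖) :=
        ((q.continuous.comp Complex.continuous_ofReal).norm.tendsto 0).mono_left
          nhdsWithin_le_nhds
      have h2 : Filter.Tendsto (fun t : ℝ => c * t ^ (N + 1)) (nhdsWithin 0 (Set.Ioi 0))
          (nhds (c * (0 : ℝ) ^ (N + 1))) :=
        ((continuous_const.mul (continuous_pow (N + 1))).tendsto (0 : ℝ)).mono_left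
          nhdsWithin_le_nhds
      have h3 := le_of_tendsto_of_tendsto h1 h2 (by
        filter_upwards [Ioc_mem_nhdsGT (zero_lt_one' ℝ)] with t ht using hq t ht.1 ht.2)
      rw [zero_pow (Nat.succ_ne_zero N), mul_zero, Complex.ofReal_zero] at h3
      rw [Polynomial.coeff_zero_eq_eval_zero]
      exact norm_le_zero_iff.1 h3
    have hdiv : q = Polynomial.X * q.divX := by
      conv_lhs => rw [← Polynomial.X_mul_divX_add q, h0, map_zero, add_zero]
    have hdivX := ih q.divX c (fun t ht ht1 => by
      have h := hq t ht ht1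
      rw [hdiv, Polynomial.eval_mul, Polynomial.eval_X, norm_mul, Complex.norm_real,
        Real.norm_of_nonneg ht.le, pow_succ] at h
      have : t * ‖q.divX.eval (t : ℂ)‖ ≤ t * (c * t ^ N) := by linarith
      exact le_of_mul_le_mul_left this ht)
    rintro (_ | m) hm
    · exact h0
    · rw [← Polynomial.coeff_divX]
      exact hdivX m (by omega)

/-- Taylor's formula for the truncated power `x_+^(N+1)`; the error bound holds for all `S` and `d`,
whether or not `0` lies between `S` and `S + d`. -/
lemma abs_max_zero_pow_sub_le (N : ℕ) (S d : ℝ) :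
    |(max (S + d) 0) ^ (N + 1) -
      ∑ a ∈ Finset.range (N + 1), ((N + 1).choose a : ℝ) * (max S 0) ^ (N + 1 - a) * d ^ a| ≤
      2 * |d| ^ (N + 1) := by
  have hd : 0 ≤ |d| ^ (N + 1) := by positivity
  have hzero : S ≤ 0 → ∑ a ∈ Finset.range (N + 1),
      ((N + 1).choose a : ℝ) * (max S 0) ^ (N + 1 - a) * d ^ a = 0 := fun hS =>
    Finset.sum_eq_zero fun a ha => by
      have := Finset.mem_range.1 ha
      rw [max_eq_right hS, zero_pow (by omega)]
      ring
  have hsum : 0 ≤ S → ∑ a ∈ Finset.range (N + 1),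
      ((N + 1).choose a : ℝ) * (max S 0) ^ (N + 1 - a) * d ^ a =
      (S + d) ^ (N + 1) - d ^ (N + 1) := fun hS => by
    rw [add_comm S d, add_pow, Finset.sum_range_succ _ (N + 1), max_eq_left hS]
    simp only [Nat.choose_self, Nat.sub_self, pow_zero, Nat.cast_one, mul_one, add_sub_cancel_right]
    exact Finset.sum_congr rfl fun a _ => by ring
  rcases le_total S 0 with hS | hS <;> rcases le_total (S + d) 0 with hSd | hSd
  · rw [hzero hS, max_eq_right hSd, zero_pow (Nat.succ_ne_zero N), sub_zero, abs_zero]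
    positivity
  · rw [hzero hS, max_eq_left hSd, sub_zero, abs_pow]
    have : |S + d| ≤ |d| := by
      rw [abs_of_nonneg hSd]
      exact le_trans (by linarith) (le_abs_self d)
    have := pow_le_pow_left₀ (abs_nonneg _) this (N + 1)
    linarith
  · rw [hsum hS, max_eq_right hSd, zero_pow (Nat.succ_ne_zero N), zero_sub, neg_sub]
    have h1 : |S + d| ≤ |d| := by
      rw [abs_of_nonpos hSd]
      exact le_trans (by linarith) (neg_le_abs d)
    have h2 := pow_le_pow_left₀ (abs_nonneg _) h1 (N + 1)
    calc |d ^ (N + 1) - (S + d) ^ (N + 1)| ≤ |d ^ (N + 1)| + |(S + d) ^ (N + 1)| := abs_sub _ _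
      _ ≤ _ := by rw [abs_pow, abs_pow]; linarith
  · rw [hsum hS, max_eq_left hSd, sub_sub_cancel, abs_pow]
    linarith

/-- Expansion in `t` of the integrand of a twisted mean with centre `t z`. -/
lemma norm_truncation_mul_exp_sub_le (N : ℕ) {M S d t : ℝ} {e : ℂ} (hS : |S| ≤ M) (hd : |d| ≤ M)
    (he : ‖e‖ ≤ M) (ht : 0 < t) (ht1 : t ≤ 1) :
    ‖(((max (S + t * d) 0) ^ (N + 1) : ℝ) : ℂ) * Complex.exp (t * e) -
      ∑ a ∈ Finset.range (N + 1), ∑ b ∈ Finset.range (N + 1), (t : ℂ) ^ (a + b) *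
        (((N + 1).choose a / b.factorial : ℂ) * (((max S 0) ^ (N + 1 - a) : ℝ) : ℂ) *
          ((d : ℂ) ^ a * e ^ b))‖ ≤
      (2 * M ^ (N + 1) * Real.exp M +
        ((2 * M) ^ (N + 1) + 2 * M ^ (N + 1)) * (M ^ (N + 1) * Real.exp M)) * t ^ (N + 1) := by
  have hM : 0 ≤ M := (abs_nonneg S).trans hS
  set x : ℝ := (max (S + t * d) 0) ^ (N + 1) with hx
  set α : ℝ := ∑ a ∈ Finset.range (N + 1),
    ((N + 1).choose a : ℝ) * (max S 0) ^ (N + 1 - a) * (t * d) ^ a with hα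
  set y : ℂ := Complex.exp (t * e) with hy
  set β : ℂ := ∑ b ∈ Finset.range (N + 1), (t * e) ^ b / b.factorial with hβ
  have htd : |t * d| ≤ t * M := by
    rw [abs_mul, abs_of_pos ht]; gcongr
  have hte : ‖(t : ℂ) * e‖ ≤ t * M := by
    rw [norm_mul, Complex.norm_real, Real.norm_of_nonneg ht.le]; gcongr
  have htM : t * M ≤ M := mul_le_of_le_one_left hM ht1
  have hprod : ∑ a ∈ Finset.range (N + 1), ∑ b ∈ Finset.range (N + 1), (t : ℂ) ^ (a + b) *
        (((N + 1).choose a / b.factorial : ℂ) * (((max S 0) ^ (N + 1 - a) : ℝ) : ℂ) *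
          ((d : ℂ) ^ a * e ^ b)) = (α : ℂ) * β := by
    rw [hα, hβ, Complex.ofReal_sum, Finset.sum_mul_sum]
    refine Finset.sum_congr rfl fun a _ => Finset.sum_congr rfl fun b _ => ?_
    push_cast
    rw [mul_pow, mul_pow, pow_add]
    ring
  have h1 : |x - α| ≤ 2 * M ^ (N + 1) * t ^ (N + 1) := by
    refine (abs_max_zero_pow_sub_le N S (t * d)).trans ?_
    have := pow_le_pow_left₀ (abs_nonneg _) htd (N + 1)
    rw [mul_pow] at this
    linarith
  have h2 : ‖y - β‖ ≤ (M ^ (N + 1) * Real.exp M) * t ^ (N + 1) := by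
    refine (Complex.norm_exp_sub_sum_le_norm_mul_exp (t * e) (N + 1)).trans ?_
    have h3 := pow_le_pow_left₀ (norm_nonneg _) hte (N + 1)
    rw [mul_pow] at h3
    have h4 : Real.exp ‖(t : ℂ) * e‖ ≤ Real.exp M := Real.exp_le_exp.2 (hte.trans htM)
    calc _ ≤ (t ^ (N + 1) * M ^ (N + 1)) * Real.exp M := by gcongr
      _ = _ := by ring
  have h5 : ‖y‖ ≤ Real.exp M :=
    (Complex.norm_exp_le_exp_norm _).trans (Real.exp_le_exp.2 (hte.trans htM))
  have h6 : |x| ≤ (2 * M) ^ (N + 1) := by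
    rw [hx, abs_pow]
    refine pow_le_pow_left₀ (abs_nonneg _) ?_ _
    rw [abs_of_nonneg (le_max_right _ _)]
    refine max_le ?_ (by linarith)
    linarith [le_abs_self S, le_abs_self (t * d)]
  have h7 : |α| ≤ (2 * M) ^ (N + 1) + 2 * M ^ (N + 1) := by
    have ht' : t ^ (N + 1) ≤ 1 := pow_le_one₀ ht.le ht1
    have : 2 * M ^ (N + 1) * t ^ (N + 1) ≤ 2 * M ^ (N + 1) :=
      mul_le_of_le_one_right (by positivity) ht'
    calc |α| = |x - (x - α)| := by rw [sub_sub_cancel]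
      _ ≤ |x| + |x - α| := abs_sub _ _
      _ ≤ _ := by linarith
  rw [hprod]
  calc ‖(x : ℂ) * y - α * β‖ = ‖((x - α : ℝ) : ℂ) * y + α * (y - β)‖ := by
        congr 1; push_cast; ring
    _ ≤ |x - α| * ‖y‖ + |α| * ‖y - β‖ := by
        refine (norm_add_le _ _).trans ?_
        rw [norm_mul, norm_mul, Complex.norm_real, Complex.norm_real, Real.norm_eq_abs,
          Real.norm_eq_abs]
    _ ≤ (2 * M ^ (N + 1) * t ^ (N + 1)) * Real.exp M +
          ((2 * M) ^ (N + 1) + 2 * M ^ (N + 1)) * ((M ^ (N + 1) * Real.exp M) * t ^ (N + 1)) := by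
        gcongr
    _ = _ := by ring

/-- The coefficient of `t ^ k` in a twisted integral that vanishes for all small `t`. -/
lemma sum_truncMoment_eq_zero {f : Cn n → ℂ} (hf : Continuous f) (k : ℕ) (R : ℝ) (D E : BiPoly n)
    (d : Cn n → ℝ) (hd : ∀ u, evalAt D u = d u) (c : ℝ) (hc : 0 ≤ c) (hdc : ∀ u, |d u| ≤ c * ‖u‖)
    (h : ∀ t : ℝ, ∫ u, f u * (((max (R - ‖u‖ ^ 2 + t * d u) 0) ^ (k + 1) : ℝ) : ℂ) *
      Complex.exp (t * evalAt E u) = 0) :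
    ∑ a ∈ Finset.range (k + 1), ((k + 1).choose a / (k - a).factorial : ℂ) *
      truncMoment f (k + 1 - a) R (D ^ a * E ^ (k - a)) = 0 := by
  have hdcont : Continuous d := by
    have : d = fun u => (evalAt D u).re := by ext u; rw [hd]; simp
    rw [this]
    exact Complex.continuous_re.comp (continuous_evalAt D)
  -- For `0 ≤ t ≤ 1` all integrands are supported in the ball of this radius.
  set ρ : ℝ := |R| + 1 + c with hρ
  have hρ1 : 1 ≤ ρ := by
    have := abs_nonneg R
    linarith
  set B : Set (Cn n) := Metric.closedBall 0 ρ with hB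
  have hout : ∀ u ∉ B, ∀ t : ℝ, 0 ≤ t → t ≤ 1 → R - ‖u‖ ^ 2 + t * d u ≤ 0 := by
    intro u hu t ht ht1
    have hu' : ρ < ‖u‖ := by simpa [hB] using hu
    have h1 : t * d u ≤ c * ‖u‖ := by
      calc t * d u ≤ t * |d u| := by gcongr; exact le_abs_self _
        _ ≤ 1 * |d u| := by gcongr
        _ ≤ c * ‖u‖ := by rw [one_mul]; exact hdc u
    have h2 : R ≤ |R| * ‖u‖ :=
      (le_abs_self R).trans (le_mul_of_one_le_right (abs_nonneg R) (by linarith))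
    nlinarith [norm_nonneg u]
  obtain ⟨M, hM⟩ : ∃ M : ℝ, ∀ u ∈ B, |R - ‖u‖ ^ 2| ≤ M ∧ |d u| ≤ M ∧ ‖evalAt E u‖ ≤ M := by
    have hcont : Continuous fun u : Cn n => |R - ‖u‖ ^ 2| + |d u| + ‖evalAt E u‖ := by
      have := continuous_evalAt E
      fun_prop
    obtain ⟨M, hM⟩ := (isCompact_closedBall (0 : Cn n) ρ).bddAbove_image hcont.continuousOn
    refine ⟨M, fun u hu => ?_⟩
    have h1 : |R - ‖u‖ ^ 2| + |d u| + ‖evalAt E u‖ ≤ M := hM ⟨u, hu, rfl⟩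
    have h2 := abs_nonneg (R - ‖u‖ ^ 2)
    have h3 := abs_nonneg (d u)
    have h4 := norm_nonneg (evalAt E u)
    exact ⟨by linarith, by linarith, by linarith⟩
  set C₀ : ℝ := 2 * M ^ (k + 1) * Real.exp M +
    ((2 * M) ^ (k + 1) + 2 * M ^ (k + 1)) * (M ^ (k + 1) * Real.exp M) with hC₀
  set w : ℕ → ℕ → ℂ := fun a b => ((k + 1).choose a / b.factorial : ℂ) *
    truncMoment f (k + 1 - a) R (D ^ a * E ^ b) with hw
  set q : Polynomial ℂ := ∑ a ∈ Finset.range (k + 1), ∑ b ∈ Finset.range (k + 1),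
    Polynomial.monomial (a + b) (w a b) with hq
  have hfB : IntegrableOn (fun u => ‖f u‖) B :=
    hf.norm.continuousOn.integrableOn_compact (isCompact_closedBall _ _)
  set T : ℝ → Cn n → ℂ := fun t u => ∑ a ∈ Finset.range (k + 1), ∑ b ∈ Finset.range (k + 1),
    (t : ℂ) ^ (a + b) * (((k + 1).choose a / b.factorial : ℂ) *
      (((max (R - ‖u‖ ^ 2) 0) ^ (k + 1 - a) : ℝ) : ℂ) * ((d u : ℂ) ^ a * evalAt E u ^ b)) with hT
  have hterm : ∀ (t : ℝ) (a b : ℕ), a ∈ Finset.range (k + 1) →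
      Integrable fun u => f u * ((t : ℂ) ^ (a + b) * (((k + 1).choose a / b.factorial : ℂ) *
        (((max (R - ‖u‖ ^ 2) 0) ^ (k + 1 - a) : ℝ) : ℂ) * ((d u : ℂ) ^ a * evalAt E u ^ b))) := by
    intro t a b ha
    obtain ⟨j, hj⟩ : ∃ j, k + 1 - a = j + 1 := ⟨k - a, by have := Finset.mem_range.1 ha; omega⟩
    refine ((integrable_truncMoment hf R j (D ^ a * E ^ b)).const_mul
      ((t : ℂ) ^ (a + b) * ((k + 1).choose a / b.factorial : ℂ))).congr
      (Filter.Eventually.of_forall fun u => ?_)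
    have : evalAt (D ^ a * E ^ b) u = (d u : ℂ) ^ a * evalAt E u ^ b := by
      rw [← hd]; simp [evalAt]
    simp only [hj, this]
    ring
  have hTint : ∀ t, Integrable fun u => f u * T t u := by
    intro t
    simp only [hT, Finset.mul_sum]
    exact integrable_finsetSum _ fun a ha => integrable_finsetSum _ fun b _ => hterm t a b ha
  have hqT : ∀ t : ℝ, q.eval (t : ℂ) = ∫ u, f u * T t u := by
    intro t
    simp only [hT, Finset.mul_sum]
    rw [integral_finsetSum _ fun a ha => integrable_finsetSum _ fun b _ => hterm t a b ha, hq,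
      Polynomial.eval_finsetSum]
    refine Finset.sum_congr rfl fun a ha => ?_
    rw [integral_finsetSum _ fun b _ => hterm t a b ha, Polynomial.eval_finsetSum]
    refine Finset.sum_congr rfl fun b _ => ?_
    simp only [hw]
    rw [Polynomial.eval_monomial, truncMoment, ← integral_const_mul, ← integral_mul_const]
    congr 1; ext u
    have : evalAt (D ^ a * E ^ b) u = (d u : ℂ) ^ a * evalAt E u ^ b := by
      rw [← hd]; simp [evalAt]
    rw [this]
    ring
  have hbound : ∀ t : ℝ, 0 < t → t ≤ 1 →
      ‖q.eval (t : ℂ)‖ ≤ (C₀ * ∫ u in B, ‖f u‖) * t ^ (k + 1) := by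
    intro t ht ht1
    set F : Cn n → ℂ := fun u => f u * (((max (R - ‖u‖ ^ 2 + t * d u) 0) ^ (k + 1) : ℝ) : ℂ) *
      Complex.exp (t * evalAt E u) with hF
    have hFint : Integrable F := by
      refine Continuous.integrable_of_hasCompactSupport ?_
        (HasCompactSupport.intro (isCompact_closedBall 0 ρ) fun u hu => ?_)
      · have := continuous_evalAt E
        fun_prop
      · rw [hF]
        simp [max_eq_right (hout u hu t ht.le ht1)]
    have hdiff : q.eval (t : ℂ) = ∫ u in B, (f u * T t u - F u) := by
      rw [setIntegral_eq_integral_of_forall_compl_eq_zero, integral_sub (hTint t) hFint, hF, h t,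
        sub_zero, hqT]
      intro u hu
      have h1 := hout u hu t ht.le ht1
      have h2 : R - ‖u‖ ^ 2 ≤ 0 := by simpa using hout u hu 0 le_rfl zero_le_one
      have h3 : T t u = 0 := Finset.sum_eq_zero fun a ha => Finset.sum_eq_zero fun b _ => by
        have := Finset.mem_range.1 ha
        rw [max_eq_right h2, zero_pow (by omega)]
        simp
      rw [h3, hF]
      simp [max_eq_right h1]
    rw [hdiff, mul_right_comm, ← integral_const_mul]
    refine norm_integral_le_of_norm_le (hfB.const_mul _)
      ((ae_restrict_iff' Metric.isClosed_closedBall.measurableSet).2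
        (Filter.Eventually.of_forall fun u hu => ?_))
    obtain ⟨h1, h2, h3⟩ := hM u hu
    have := norm_truncation_mul_exp_sub_le k h1 h2 h3 ht ht1
    rw [norm_sub_rev]
    calc ‖F u - f u * T t u‖ = ‖f u‖ * ‖(((max (R - ‖u‖ ^ 2 + t * d u) 0) ^ (k + 1) : ℝ) : ℂ) *
          Complex.exp (t * evalAt E u) - T t u‖ := by
          rw [← norm_mul, mul_sub, ← mul_assoc]
      _ ≤ ‖f u‖ * (C₀ * t ^ (k + 1)) := by gcongr
      _ = _ := mul_comm _ _
  have hcoeff := coeff_eq_zero_of_norm_eval_le (k + 1) q _ hbound k (by omega)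
  rw [hq, Polynomial.finsetSum_coeff] at hcoeff
  rw [← hcoeff]
  refine Finset.sum_congr rfl fun a ha => ?_
  have hak := Finset.mem_range.1 ha
  rw [Polynomial.finsetSum_coeff, Finset.sum_eq_single (k - a)]
  · rw [Polynomial.coeff_monomial, if_pos (by omega)]
  · intro b _ hb
    rw [Polynomial.coeff_monomial, if_neg (by omega)]
  · intro hk
    exact absurd (Finset.mem_range.2 (by omega)) hk

/-! ### Twisted means as integrals over the whole space -/

/-- If the integrals of `h` over all spheres centred at the origin vanish, so does the integral of
`h` against any radial function. -/
lemma integral_mul_radial_eq_zero [NeZero n] {h : Cn n → ℂ} (hh : Continuous h)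
    (hsph : ∀ r : ℝ, 0 < r → ∫ w, h w ∂(sphereMeasure n r) = 0) (χ : ℝ → ℂ) :
    ∫ w, h w * χ ‖w‖ = 0 := by
  set ν := (volume : Measure (Cn n)).toSphere with hν
  have hsphere : ∀ r : ℝ, 0 < r → ∫ x : Metric.sphere (0 : Cn n) 1, h (r • (x : Cn n)) ∂ν = 0 := by
    intro r hr
    have h1 := hsph r hr
    rw [sphereMeasure, integral_map (by fun_prop) hh.aestronglyMeasurable,
      integral_smul_measure] at h1
    have hne : ν Set.univ ≠ 0 := by
      rw [Ne, Measure.measure_univ_eq_zero]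
      exact Measure.toSphere_ne_zero _
    refine (smul_eq_zero.1 h1).resolve_left ?_
    exact ENNReal.toReal_ne_zero.2 ⟨ENNReal.inv_ne_zero.2 (measure_ne_top _ _), ENNReal.inv_ne_top.2 hne⟩
  set g : Metric.sphere (0 : Cn n) 1 × Set.Ioi (0 : ℝ) → ℂ :=
    fun p => h ((p.2 : ℝ) • (p.1 : Cn n)) * χ p.2 with hg
  have hpolar : ∫ w, h w * χ ‖w‖ =
      ∫ p, g p ∂(ν.prod (.volumeIoiPow (Module.finrank ℝ (Cn n) - 1))) := by
    calc ∫ w, h w * χ ‖w‖ = ∫ w : ({(0)}ᶜ : Set (Cn n)), h w * χ ‖(w : Cn n)‖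
          ∂((volume : Measure (Cn n)).comap (↑)) := by
          rw [integral_subtype_comap (measurableSet_singleton _).compl fun w => h w * χ ‖w‖,
            restrict_compl_singleton]
      _ = _ := by
          rw [← ((volume : Measure (Cn n)).measurePreserving_homeomorphUnitSphereProd).integral_comp
            (Homeomorph.measurableEmbedding _) g]
          refine integral_congr_ae (Filter.Eventually.of_forall fun w => ?_)
          have hw : ‖(w : Cn n)‖ ≠ 0 := norm_ne_zero_iff.2 w.2
          simp [g, smul_smul, hw]
  rw [hpolar]
  -- Without integrability the integral is zero by convention.
  by_cases hint : Integrable g (ν.prod (.volumeIoiPow (Module.finrank ℝ (Cn n) - 1)))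
  · rw [integral_prod_symm _ hint]
    simp only [hg, integral_mul_const]
    simp only [fun r : Set.Ioi (0 : ℝ) => hsphere r r.2, zero_mul, integral_zero]
  · exact integral_undef hint

lemma realify_add (z w : Cn n) : realify (z + w) = realify z + realify w := by
  ext s; rcases s with j | j <;> simp [realify]

lemma realify_smul (t : ℝ) (z : Cn n) : realify (t • z) = t • realify z := by
  ext s; rcases s with j | j <;> simp [realify]

lemma act_add (M : Matrix (Fin n ⊕ Fin n) (Fin n ⊕ Fin n) ℝ) (z w : Cn n) :
    act M (z + w) = act M z + act M w := by
  ext j; simp [act, complexify, realify_add, Matrix.mulVec_add]; ring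

lemma act_smul (M : Matrix (Fin n ⊕ Fin n) (Fin n ⊕ Fin n) ℝ) (t : ℝ) (z : Cn n) :
    act M (t • z) = t • act M z := by
  ext j; simp [act, complexify, realify_smul, Matrix.mulVec_smul]; ring

/-- The phase `w ↦ ∑ k, λ_k Re (z · conj (U^{(k)} w))` of the twisted mean, a real linear form. -/
def phase {m : ℕ} (U : Fin m → Matrix (Fin n ⊕ Fin n) (Fin n ⊕ Fin n) ℝ) (lam : Fin m → ℝ)
    (z : Cn n) : Cn n →ₗ[ℝ] ℝ where
  toFun w := ∑ k, lam k * (∑ l, z l * (starRingEnd ℂ) (act (U k) w l)).re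
  map_add' v w := by
    simp only [act_add, PiLp.add_apply, map_add, mul_add, Finset.sum_add_distrib, Complex.add_re]
  map_smul' t w := by
    simp only [act_smul, PiLp.smul_apply, Complex.real_smul, map_mul, Complex.conj_ofReal,
      mul_left_comm _ (t : ℂ), ← Finset.mul_sum, Complex.re_ofReal_mul, mul_left_comm _ t,
      RingHom.id_apply, smul_eq_mul]

lemma phase_smul {m : ℕ} (U : Fin m → Matrix (Fin n ⊕ Fin n) (Fin n ⊕ Fin n) ℝ)
    (lam : Fin m → ℝ) (t : ℝ) (z w : Cn n) :
    phase U lam ((t : ℂ) • z) w = t * phase U lam z w := by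
  simp only [phase, LinearMap.coe_mk, AddHom.coe_mk, PiLp.smul_apply, smul_eq_mul, mul_assoc,
    ← Finset.mul_sum, Complex.re_ofReal_mul, mul_left_comm _ t]

/-- A real linear form is the value of a homogeneous polynomial of degree one in `z, z̄`. -/
lemma exists_evalAt_eq_linearForm (L : Cn n →ₗ[ℝ] ℝ) :
    ∃ Q : BiPoly n, Q.IsHomogeneous 1 ∧ ∀ u, evalAt Q u = L u := by
  set p : Fin n → ℝ := fun j => L (EuclideanSpace.single j 1) with hp
  set q : Fin n → ℝ := fun j => L (EuclideanSpace.single j Complex.I) with hq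
  refine ⟨∑ j, (C ((p j - q j * Complex.I) / 2) * X (Sum.inl j) +
    C ((p j + q j * Complex.I) / 2) * X (Sum.inr j)), IsHomogeneous.sum _ _ _ fun j _ =>
      IsHomogeneous.add (by simpa using (isHomogeneous_C _ _).mul (isHomogeneous_X ℂ _))
        (by simpa using (isHomogeneous_C _ _).mul (isHomogeneous_X ℂ _)), fun u => ?_⟩
  have hu : u = ∑ j, ((u j).re • EuclideanSpace.single j (1 : ℂ) +
      (u j).im • EuclideanSpace.single j Complex.I) := by
    ext i
    simp [Finset.sum_add_distrib, Pi.single_apply]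
  have hL : L u = ∑ j, ((u j).re * p j + (u j).im * q j) := by
    conv_lhs => rw [hu]
    simp only [map_sum, map_add, map_smul, smul_eq_mul, hp, hq]
  rw [hL]
  simp only [evalAt, map_sum, map_add, map_mul, eval_C, eval_X, Sum.elim_inl, Sum.elim_inr,
    Complex.ofReal_sum]
  refine Finset.sum_congr rfl fun j _ => ?_
  apply Complex.ext <;> simp <;> ring

lemma evalAt_antiPoly_add_holPoly (z u : Cn n) :
    evalAt (antiPoly z + holPoly z) u = ((2 * (inner ℂ u z).re : ℝ) : ℂ) := by
  rw [PiLp.inner_apply]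
  simp only [evalAt, antiPoly, holPoly, map_add, map_sum, map_mul, eval_C, eval_X, Sum.elim_inl,
    Sum.elim_inr, ← Finset.sum_add_distrib, Complex.re_sum, Finset.mul_sum, Complex.ofReal_sum]
  refine Finset.sum_congr rfl fun j _ => ?_
  apply Complex.ext <;> simp [RCLike.inner_apply] <;> ring

/-- The vanishing of the twisted means with centre `t z`, integrated against a truncated power of
`R + t²|z|² - |w|²`.  This choice of the radius cancels the square of `t z`. -/
lemma integral_twisted_eq_zero [NeZero n] {m : ℕ}
    (U : Fin m → Matrix (Fin n ⊕ Fin n) (Fin n ⊕ Fin n) ℝ) (lam : Fin m → ℝ)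
    {f : Cn n → ℂ} (hf : Continuous f) (z : Cn n) (t : ℝ)
    (h : ∀ r : ℝ, 0 < r → twistedMean U lam f r ((t : ℂ) • z) = 0) (N : ℕ) (R : ℝ) :
    ∫ u, f u * (((max (R - ‖u‖ ^ 2 + t * (2 * (inner ℂ u z).re)) 0) ^ N : ℝ) : ℂ) *
      Complex.exp (t * (-(Complex.I / 2) * phase U lam z u)) = 0 := by
  set z' : Cn n := (t : ℂ) • z with hz'
  have hphase : Continuous (phase U lam z') := LinearMap.continuous_of_finiteDimensional _
  have hcont : Continuous fun w => f (z' - w) *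
      Complex.exp (Complex.I / 2 * (phase U lam z' w : ℂ)) := by
    fun_prop
  have key := integral_mul_radial_eq_zero hcont h
    fun r => (((max (R + t ^ 2 * ‖z‖ ^ 2 - r ^ 2) 0) ^ N : ℝ) : ℂ)
  rw [← integral_sub_left_eq_self _ volume z'] at key
  have hne : Complex.exp (Complex.I / 2 * (phase U lam z' z' : ℂ)) ≠ 0 := Complex.exp_ne_zero _
  refine (mul_eq_zero.1 (Eq.trans ?_ key)).resolve_left hne
  rw [← integral_const_mul]
  congr 1; ext u
  have hexp : Complex.exp (Complex.I / 2 * (phase U lam z' (z' - u) : ℂ)) =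
      Complex.exp (Complex.I / 2 * (phase U lam z' z' : ℂ)) *
        Complex.exp (t * (-(Complex.I / 2) * phase U lam z u)) := by
    rw [← Complex.exp_add, map_sub, hz', phase_smul U lam t z u]
    congr 1
    push_cast
    ring
  have hnorm : R + t ^ 2 * ‖z‖ ^ 2 - ‖z' - u‖ ^ 2 =
      R - ‖u‖ ^ 2 + t * (2 * (inner ℂ u z).re) := by
    have h1 := norm_sub_sq (𝕜 := ℂ) u z'
    have h2 : RCLike.re (inner ℂ u z') = t * (inner ℂ u z).re := by
      rw [hz', inner_smul_right]
      exact Complex.re_ofReal_mul _ _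
    have h3 : ‖z'‖ ^ 2 = t ^ 2 * ‖z‖ ^ 2 := by
      rw [hz', norm_smul, Complex.norm_real, mul_pow, Real.norm_eq_abs, sq_abs]
    rw [norm_sub_rev, h1, h2, h3]
    ring
  rw [sub_sub_cancel, hexp, hnorm]
  ring

/-! ### Uniqueness -/

/-- The coefficient of `t ^ k`, solved for its term without the factor `E`: the first moment of `D ^ k`
is a sum of moments of higher order. -/
lemma exists_reduction {f : Cn n → ℂ} (k : ℕ) {D E : BiPoly n} (hD : D.IsHomogeneous 1)
    (hE : E.IsHomogeneous 1)
    (h : ∀ R, ∑ a ∈ Finset.range (k + 1), ((k + 1).choose a / (k - a).factorial : ℂ) *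
      truncMoment f (k + 1 - a) R (D ^ a * E ^ (k - a)) = 0) :
    ∃ Q : Fin k → BiPoly n, (∀ b, (Q b).IsHomogeneous k) ∧
      ∀ R, truncMoment f 1 R (D ^ k) = ∑ b : Fin k, truncMoment f (b + 2) R (Q b) := by
  set v : ℕ → ℂ := fun a => (k + 1).choose a / (k - a).factorial with hv
  set Q : ℕ → BiPoly n := fun b =>
    (-(v (k - 1 - b) / (k + 1))) • (D ^ (k - 1 - b) * E ^ (k - (k - 1 - b))) with hQ
  refine ⟨fun b => Q b, fun b => ?_, fun R => ?_⟩
  · refine Submodule.smul_mem (homogeneousSubmodule _ ℂ k) _ ?_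
    have := (hD.pow (k - 1 - b)).mul (hE.pow (k - (k - 1 - b)))
    have hk : 1 * (k - 1 - b) + 1 * (k - (k - 1 - b)) = k := by omega
    rw [hk] at this
    exact this
  · have h1 := h R
    rw [Finset.sum_range_succ] at h1
    simp only [Nat.sub_self, Nat.factorial_zero, Nat.add_sub_cancel_left, pow_zero, mul_one,
      Nat.choose_succ_self_right] at h1
    have hk : ((k : ℂ) + 1) ≠ 0 := Nat.cast_add_one_ne_zero k
    have h2 : truncMoment f 1 R (D ^ k) = ∑ a ∈ Finset.range k,
        (-(v a / (k + 1))) * truncMoment f (k + 1 - a) R (D ^ a * E ^ (k - a)) := by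
      simp only [neg_mul, div_mul_eq_mul_div, Finset.sum_neg_distrib, ← Finset.sum_div]
      rw [← neg_div, eq_div_iff hk]
      push_cast at h1
      simp only [div_one] at h1
      linear_combination h1
    rw [h2, ← Finset.sum_range_reflect,
      Fin.sum_univ_eq_sum_range (fun b => truncMoment f (b + 2) R (Q b))]
    refine Finset.sum_congr rfl fun b hb => ?_
    have hbk := Finset.mem_range.1 hb
    rw [hQ, truncMoment_smul]
    congr 2
    omega

/-- The moments of a function whose twisted means vanish on a non-harmonic complex cone vanish, by
induction on the degree.  In degree `k` the polynomials divisible by `|u|²` are covered by degree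
`k - 2`; the powers `⟨u, z⟩ ^ k` with `z ∈ K` reduce to moments of higher order. -/
theorem truncMoment_eq_zero [NeZero n] {m : ℕ}
    (U : Fin m → Matrix (Fin n ⊕ Fin n) (Fin n ⊕ Fin n) ℝ) (lam : Fin m → ℝ)
    {K : Set (Cn n)} (hK : IsComplexCone K) (hKharm : IsNonHarmonic K)
    {f : Cn n → ℂ} (hf : Continuous f)
    (hmean : ∀ r : ℝ, 0 < r → ∀ z ∈ K, twistedMean U lam f r z = 0) (k : ℕ) :
    ∀ P : BiPoly n, P.IsHomogeneous k → ∀ R, truncMoment f 1 R P = 0 := by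
  induction k using Nat.strong_induction_on with
  | _ k ih =>
  refine truncMoment_eq_zero_of_reduction hf (W := homogeneousSubmodule _ ℂ k)
    (homogeneousSubmodule_fg _ ℂ k) k fun P hP => ?_
  refine Submodule.span_induction ?_ ?_ ?_ ?_ (homogeneous_mem_span hK hKharm k P hP)
  · rintro _ (⟨z, hz, rfl⟩ | ⟨P', i, hi, hP', rfl⟩)
    · obtain ⟨Q, hQ, hQz⟩ := exists_evalAt_eq_linearForm (phase U lam z)
      have hE : (C (-(Complex.I / 2)) * Q).IsHomogeneous 1 := by
        simpa using (isHomogeneous_C _ (-(Complex.I / 2))).mul hQ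
      refine exists_reduction k ((isHomogeneous_antiPoly z).add (isHomogeneous_holPoly z)) hE
        fun R => sum_truncMoment_eq_zero hf k R _ _ (fun u => 2 * (inner ℂ u z).re)
          (evalAt_antiPoly_add_holPoly z) (2 * ‖z‖) (by positivity) (fun u => ?_) (fun t => ?_)
      · have h1 : |(inner ℂ u z).re| ≤ ‖u‖ * ‖z‖ :=
          (Complex.abs_re_le_norm _).trans (norm_inner_le_norm u z)
        rw [abs_mul, abs_two]
        linarith
      · have := integral_twisted_eq_zero U lam hf z t
          (fun r hr => hmean r hr _ (hK z hz t)) (k + 1) R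
        have hEu : ∀ u, evalAt (C (-(Complex.I / 2)) * Q) u =
            -(Complex.I / 2) * phase U lam z u := fun u => by
          rw [evalAt_mul, hQz]; simp [evalAt]
        simpa only [hEu] using this
    · have h1 := ih i (by omega) P' hP'
      refine ⟨fun _ => 0, fun _ => Submodule.zero_mem _, fun R => ?_⟩
      rw [truncMoment_normSqPoly_mul hf, h1 R, truncMoment_two_eq_zero hf h1 R]
      simp [truncMoment_zero]
  · exact ⟨fun _ => 0, fun _ => Submodule.zero_mem _, fun R => by simp [truncMoment_zero]⟩
  · rintro P P' _ _ ⟨Q, hQ, hPQ⟩ ⟨Q', hQ', hPQ'⟩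
    refine ⟨fun b => Q b + Q' b, fun b => Submodule.add_mem _ (hQ b) (hQ' b), fun R => ?_⟩
    simp only [truncMoment_add hf 0 R, truncMoment_add hf _ R, hPQ, hPQ', Finset.sum_add_distrib]
  · rintro c P _ ⟨Q, hQ, hPQ⟩
    refine ⟨fun b => c • Q b, fun b => Submodule.smul_mem _ c (hQ b), fun R => ?_⟩
    simp only [truncMoment_smul, hPQ, Finset.mul_sum]

/-- Uniqueness for twisted spherical means with an arbitrary family of matrices `U`. -/
theorem eq_zero_of_twistedMean_eq_zero [NeZero n] {m : ℕ}
    (U : Fin m → Matrix (Fin n ⊕ Fin n) (Fin n ⊕ Fin n) ℝ) (lam : Fin m → ℝ)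
    {K : Set (Cn n)} (hK : IsComplexCone K) (hKharm : IsNonHarmonic K)
    {f : Cn n → ℂ} (hf : Continuous f)
    (hmean : ∀ r : ℝ, 0 < r → ∀ z ∈ K, twistedMean U lam f r z = 0) : f = 0 := by
  refine eq_zero_of_truncMoment_eq_zero hf fun P R => ?_
  rw [← sum_homogeneousComponent P, truncMoment_sum hf]
  exact Finset.sum_eq_zero fun k _ => truncMoment_eq_zero U lam hK hKharm hf hmean k _
    (homogeneousComponent_isHomogeneous k P) R

end Metivier

end

theorem mainTheorem3 {𝔤 : Type*} [LieRing 𝔤] [LieAlgebra ℝ 𝔤]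
    (g : LinearMap.BilinForm ℝ 𝔤) (hg : Metivier.IsMetivier g)
    (n m : ℕ) (hn : 2 ≤ n)
    (B : Module.Basis (Fin n ⊕ Fin n) ℝ (Metivier.horizontal g))
    (hB : Metivier.IsOrthonormalFor g B)
    (Z : Module.Basis (Fin m) ℝ (Metivier.centre 𝔤))
    (hZ : Metivier.IsOrthonormalFor g Z)
    (lam : Fin m → ℝ) (hlam : lam ≠ 0)
    (μ : Fin n → ℝ) (A : Matrix (Fin n ⊕ Fin n) (Fin n ⊕ Fin n) ℝ)
    (hA : Metivier.IsNormalizing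
      (Metivier.VMatrix (Metivier.structureMatrix hg B Z) lam) μ A)
    (K : Set (Metivier.Cn n)) (hK : Metivier.IsComplexCone K)
    (hKharm : Metivier.IsNonHarmonic K)
    (hKaxis : Metivier.ContainsCoordinateAxis (Metivier.transformedCone A K))
    (f : Metivier.Cn n → ℂ) (hf : Continuous f)
    (hmean : ∀ r : ℝ, 0 < r → ∀ z ∈ K,
      Metivier.twistedMean (Metivier.structureMatrix hg B Z) lam f r z = 0) :
    f = 0 := by
  have : NeZero n := ⟨by omega⟩
  exact Metivier.eq_zero_of_twistedMean_eq_zero _ lam hK hKharm hf hmean
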